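/- Setting. Let $G=(V,E)$ be a finite simple undirected graph with $n=|V|\ge 2$ vertices, let $w:E\to\{0,1,2,\dots\}$ be integer edge weights with sum $W$, and let $s\in V$. For $\varepsilon>0$, an $\varepsilon$-approximate shortest path from $s$ to $v$ is a path in $G$ from $s$ to $v$ whose length (sum of edge weights) is at most $(1+\varepsilon)$ times the length of a shortest path from $s$ to $v$. Model. In the W-Stream model with memory parameter $M$, the input stream is the list of the weighted edges in arbitrary order, each edge being listed once in an arbitrary orientation; $n$, $M$, $\varepsilon$ and $s$ are known in advance. In each pass the algorithm reads the current stream once, sequentially, and writes a new stream, which is the input of the next pass. The working memory has $O(M\log n)$ bits, each stream record has $O(\log n)$ bits, and computation inside the working memory is free. Here each intermediate stream may have $O((|V|+|E|)\sqrt M)$ records. The output is the last stream. It is a list of pairs (vertex, predecessor), one for each vertex $v\neq s$ that is reachable from $s$; the path reported for $v$ is found by following predecessors from $v$ back to $s$. Lemma. Let $c\in\mathbb N$ and $\alpha>1$ be constants. There is a randomised W-Stream algorithm which, for all $n\ge 2$, $1\le M\le n^2$, $\varepsilon>0$, every such $(G,w)$ with $W\le n^{c}$ (so $\log W=O(\log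 n)$), every source $s$ and every order of the edge list, always halts after $$O\!\left(\frac{(1+\varepsilon)\,n\,\log_2 n\,\log_2\max(W,2)}{\varepsilon\sqrt M}\right)$$ passes and, with probability at least $1-n^{-(\alpha-1)}$, reports $\varepsilon$-approximate shortest paths from $s$ to all vertices that are reachable from $s$, simultaneously. All the constants in the $O(\cdot)$ bounds depend only on $c$ and $\alpha$. The algorithm may be a different one for each choice of $(n,M,\varepsilon)$, but it does not depend on the graph, the weights, the source or the order of the edge list. -/

import Mathlib

/-- A randomised one-tape streaming algorithm that may write an intermediate stream in every pass.
`Src` is the side input (known before the first pass), `Inp` the type of the records of the input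
stream, `Out` the type of the records of the output stream.

All information that the algorithm keeps inside a pass or carries from one pass to the next, its
random choices and its pass counters included, is in the working memory (an element of `Mem`) or
on the stream (a list over `Rec`). Computation on the content of the working memory is free. -/
structure WStreamAlgorithm (Src Inp Out : Type) where
  /-- the possible contents of the working memory -/
  Mem : Type
  /-- the records of which the streams consist -/
  Rec : Type
  [memFintype : Fintype Mem]
  [recFintype : Fintype Rec]
  /-- the record by which a record of the input stream is represented -/
  encode : Inp → Rec
  /-- the result represented by a record of the last stream -/
  decode : Rec → Out
  /-- the distribution of the working memory before the first pass -/
  start : Src → PMF Mem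
  /-- reading one record: the memory is updated, and some records are written -/
  step : Mem → Rec → Mem × List Rec
  /-- reaching the end of the stream: the memory is updated, and some records are written -/
  finish : Mem → Mem × List Rec
  /-- whether to stop, rather than to start another pass -/
  halted : Mem → Bool

namespace WStreamAlgorithm

variable {Src Inp Out : Type} (A : WStreamAlgorithm Src Inp Out)

/-- The number of possible contents of the working memory; with `b` bits it is `2 ^ b`. -/
def memSize : ℕ := @Fintype.card A.Mem A.memFintype

/-- The number of different records. -/
def recSize : ℕ := @Fintype.card A.Rec A.recFintype

/-- One pass over a stream: the working memory at its end, and the stream that was written. -/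
def pass : A.Mem → List A.Rec → A.Mem × List A.Rec
  | q, [] => A.finish q
  | q, r :: rs =>
    ((pass (A.step q r).1 rs).1, (A.step q r).2 ++ (pass (A.step q r).1 rs).2)

/-- The working memory and the current stream after `k` passes, when the working memory was `q`
before the first pass. -/
def config (q : A.Mem) (input : List Inp) : ℕ → A.Mem × List A.Rec
  | 0 => (q, input.map A.encode)
  | k + 1 => A.pass (config q input k).1 (config q input k).2

/-- The algorithm makes exactly `p` passes. -/
def HaltsAfter (q : A.Mem) (input : List Inp) (p : ℕ) : Prop :=
  A.halted (A.config q input p).1 = true ∧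
    ∀ k < p, A.halted (A.config q input k).1 = false

/-- The algorithm halts, and `out` is the content of the last stream that it wrote. -/
def Outputs (q : A.Mem) (input : List Inp) (out : List Out) : Prop :=
  ∃ p, A.HaltsAfter q input p ∧ out = (A.config q input p).2.map A.decode

end WStreamAlgorithm

section Graphs

variable {V : Type} [Fintype V]

open Classical in
/-- The sum `W` of the weights of all edges. -/
noncomputable def totalWeight (G : SimpleGraph V) (w : Sym2 V → ℕ) : ℕ :=
  ∑ e ∈ G.edgeFinset, w e

/-- `L` is an unordered edge list of the weighted graph: every edge `{u, v}` occurs exactly once,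
as `(u, v, weight)` or as `(v, u, weight)`, and nothing else occurs. -/
def IsEdgeList (G : SimpleGraph V) (w : Sym2 V → ℕ) (L : List (V × V × ℕ)) : Prop :=
  (L.map fun r => s(r.1, r.2.1)).Nodup ∧
    (∀ e : Sym2 V, e ∈ G.edgeSet ↔ e ∈ L.map fun r => s(r.1, r.2.1)) ∧
    ∀ r ∈ L, r.2.2 = w s(r.1, r.2.1)

/-- The length of a walk: the sum of the weights of its edges. -/
def walkLength {G : SimpleGraph V} (w : Sym2 V → ℕ) {u v : V} (P : G.Walk u v) : ℕ :=
  (P.edges.map w).sum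

/-- `P` is a path from `s` to `v` whose length is at most `1 + ε` times the length of a shortest
path from `s` to `v`, that is, of any path from `s` to `v`. -/
def IsApproxShortestPath {G : SimpleGraph V} (w : Sym2 V → ℕ) (ε : ℝ) {s v : V}
    (P : G.Walk s v) : Prop :=
  P.IsPath ∧ ∀ Q : G.Walk s v, Q.IsPath → (walkLength w P : ℝ) ≤ (1 + ε) * walkLength w Q

/-- The list `out` of pairs (vertex, predecessor) represents `ε`-approximate shortest paths from
`s` to all vertices. Exactly the vertices other than `s` that can be reached from `s` have a
predecessor, each of them one; and for each vertex `v` that can be reached from `s`, following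
the predecessors from `v` on yields, in reverse, an `ε`-approximate shortest path from `s`. -/
def RepresentsApproxShortestPaths (G : SimpleGraph V) (w : Sym2 V → ℕ) (ε : ℝ) (s : V)
    (out : List (V × V)) : Prop :=
  (out.map Prod.fst).Nodup ∧
    (∀ v, v ∈ out.map Prod.fst ↔ v ≠ s ∧ G.Reachable s v) ∧
    ∀ v, G.Reachable s v → ∃ P : G.Walk s v,
      (∀ d ∈ P.darts, (d.snd, d.fst) ∈ out) ∧ IsApproxShortestPath w ε P

end Graphs

/-! Take `K = ⌊√M⌋` uniform random vertices and call them, together with the source, centres. Fix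
one shortest path from `s` to every reachable vertex. If `h` is a suitable multiple of `n log n /
K`, a given window of `h` consecutive path vertices is missed by the sample with probability at most
`n ^ (-(α + 1))`. There are at most `n ^ 2` windows, so with high probability every fixed path
splits into segments of at most `h` edges that begin at centres (`exists_good_samples`). It remains
to approximate the lengths of such segments and to join them.

Segments are handled at about `log W` scales. At the scale that fits its length, a segment has
rounded length at most `h * E + h`, and rounding costs a factor of at most `(E + 2) / E` up to an
additive `h` (`ScalesDone.segment`). Rounded weights are positive integers, so one search by levels
can run from all centres at once. A pass enters at most `M` new pairs (vertex, centre), and a pass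
that enters fewer than `M` completes its level. Hence each scale is finished after `h * E + h + n *
(K + 1) / M + 1` collecting passes (`SearchState.radius_lt`), which is of order `(1 + ε) n log n /
(ε √M)`.

The data of the pairs lives on the stream, copied into a cell for each oriented edge and centre. The
memory holds only the centres, at most `M` pending entries, at most `4 * M` distances between
centres, and `M` selected predecessors.

Predecessors come from different scales and must still form a tree. All bounds are therefore
measured in the single positive weight `B * (h * E) * w + 1`, and every recorded bound exceeds some
bound of its recorded predecessor by at least the weight of the edge (`Supported`). If each vertex
takes the predecessor from a shortest chain of segments, the least chain value drops strictly along
predecessors, which yields paths (`IsChoice.exists_path`). The additive errors of a chain stay below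
`B * h`, so integrality removes them (`representsApproxShortestPaths`). -/

/-! ### Stream programs and their execution as W-Stream algorithms. -/

/-- A multi-pass stream program in which the control is constant during a pass, an accumulator is
filled in during the pass, and the records written depend on the control alone. -/
structure StreamProgram (Ctl Acc Rec Inp Out : Type) where
  encode : Inp → Rec
  decode : Rec → Out
  init : Acc
  read : Ctl → Acc → Rec → Acc
  write : Ctl → Rec → List Rec
  close : Ctl → Acc → Ctl × List Rec
  halted : Ctl → Bool

namespace StreamProgram

variable {Ctl Acc Rec Src Inp Out : Type} (P : StreamProgram Ctl Acc Rec Inp Out)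

/-- The effect of one pass on the control and the stream. -/
def next (y : Ctl × List Rec) : Ctl × List Rec :=
  ((P.close y.1 (y.2.foldl (P.read y.1) P.init)).1,
    y.2.flatMap (P.write y.1) ++ (P.close y.1 (y.2.foldl (P.read y.1) P.init)).2)

/-- The control and the stream after `k` passes. -/
def run (c : Ctl) (L : List Inp) (k : ℕ) : Ctl × List Rec :=
  P.next^[k] (c, L.map P.encode)

lemma run_zero (c : Ctl) (L : List Inp) : P.run c L 0 = (c, L.map P.encode) := rfl

lemma run_succ (c : Ctl) (L : List Inp) (k : ℕ) :
    P.run c L (k + 1) = P.next (P.run c L k) := Function.iterate_succ_apply' _ _ _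

/-- Finite sets of controls, accumulators and records that a program never leaves. -/
structure Bound where
  ctl : Finset Ctl
  acc : Finset Acc
  recs : Finset Rec
  encode_mem : ∀ i, P.encode i ∈ recs
  init_mem : P.init ∈ acc
  read_mem : ∀ c ∈ ctl, ∀ a ∈ acc, ∀ r ∈ recs, P.read c a r ∈ acc
  write_mem : ∀ c ∈ ctl, ∀ r ∈ recs, ∀ r' ∈ P.write c r, r' ∈ recs
  close_ctl : ∀ c ∈ ctl, ∀ a ∈ acc, (P.close c a).1 ∈ ctl
  close_recs : ∀ c ∈ ctl, ∀ a ∈ acc, ∀ r ∈ (P.close c a).2, r ∈ recs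

variable {P} (b : P.Bound)

/-- The W-Stream algorithm that executes a program of bounded size. -/
noncomputable def Bound.algorithm (start : Src → PMF b.ctl) : WStreamAlgorithm Src Inp Out where
  Mem := b.ctl × b.acc
  Rec := b.recs
  encode i := ⟨P.encode i, b.encode_mem i⟩
  decode r := P.decode r
  start s := (start s).map fun c => (c, ⟨P.init, b.init_mem⟩)
  step q r := ((q.1, ⟨P.read q.1 q.2 r, b.read_mem _ q.1.2 _ q.2.2 _ r.2⟩),
    (P.write q.1 r).attachWith (· ∈ b.recs) (b.write_mem _ q.1.2 _ r.2))
  finish q := ((⟨(P.close q.1 q.2).1, b.close_ctl _ q.1.2 _ q.2.2⟩, ⟨P.init, b.init_mem⟩),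
    (P.close q.1 q.2).2.attachWith (· ∈ b.recs) (b.close_recs _ q.1.2 _ q.2.2))
  halted q := P.halted q.1

variable (start : Src → PMF b.ctl)

lemma Bound.memSize_algorithm : (b.algorithm start).memSize = b.ctl.card * b.acc.card := by
  change Fintype.card (b.ctl × b.acc) = _
  simp

lemma Bound.recSize_algorithm : (b.algorithm start).recSize = b.recs.card := by
  change Fintype.card b.recs = _
  simp

/-- Only the accumulator changes while records are read; so the induction keeps the control fixed
and lets the accumulator vary. -/
lemma Bound.pass_algorithm (c : b.ctl) (a : b.acc) (rs : List b.recs) :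
    let y := (b.algorithm start).pass (c, a) rs
    let e := P.close c ((rs.map Subtype.val).foldl (P.read c) a)
    (y.1.1 : Ctl) = e.1 ∧ y.1.2 = ⟨P.init, b.init_mem⟩ ∧
      y.2.map Subtype.val = (rs.map Subtype.val).flatMap (P.write c) ++ e.2 := by
  induction rs generalizing a with
  | nil => exact ⟨rfl, rfl, by simp [WStreamAlgorithm.pass, Bound.algorithm]⟩
  | cons r rs ih =>
    obtain ⟨h1, h2, h3⟩ := ih ⟨P.read c a r, b.read_mem _ c.2 _ a.2 _ r.2⟩
    refine ⟨h1, h2, ?_⟩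
    refine (List.map_append (f := Subtype.val)
      (l₁ := (P.write c r).attachWith (· ∈ b.recs) (b.write_mem _ c.2 _ r.2))).trans
      ((congrArg₂ (· ++ ·) (List.attachWith_map_subtype_val _) h3).trans ?_)
    simp

lemma Bound.config_algorithm (c : b.ctl) (L : List Inp) (k : ℕ) :
    let y := (b.algorithm start).config (c, ⟨P.init, b.init_mem⟩) L k
    (y.1.1 : Ctl) = (P.run c L k).1 ∧ y.1.2 = ⟨P.init, b.init_mem⟩ ∧
      y.2.map Subtype.val = (P.run c L k).2 := by
  induction k with
  | zero => exact ⟨rfl, rfl, by simp [WStreamAlgorithm.config, Bound.algorithm, run_zero,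
      Function.comp_def]⟩
  | succ k ih =>
    obtain ⟨h1, h2, h3⟩ := ih
    rw [run_succ]
    set y := (b.algorithm start).config (c, ⟨P.init, b.init_mem⟩) L k with hy
    have hc : (b.algorithm start).config (c, ⟨P.init, b.init_mem⟩) L (k + 1) =
      (b.algorithm start).pass (y.1.1, y.1.2) y.2 := rfl
    rw [hc]
    obtain ⟨g1, g2, g3⟩ := b.pass_algorithm start y.1.1 y.1.2 y.2
    refine ⟨?_, g2, ?_⟩
    · rw [g1, next, ← h1, ← h3, h2]
    · rw [g3, next, ← h1, ← h3, h2]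

lemma Bound.halted_config (c : b.ctl) (L : List Inp) (k : ℕ) :
    (b.algorithm start).halted ((b.algorithm start).config (c, ⟨P.init, b.init_mem⟩) L k).1 =
      P.halted (P.run c L k).1 :=
  congrArg P.halted (b.config_algorithm start c L k).1

lemma Bound.length_config (c : b.ctl) (L : List Inp) (k : ℕ) :
    ((b.algorithm start).config (c, ⟨P.init, b.init_mem⟩) L k).2.length =
      (P.run c L k).2.length :=
  (List.length_map _).symm.trans (congrArg List.length (b.config_algorithm start c L k).2.2)

lemma Bound.map_decode_config (c : b.ctl) (L : List Inp) (k : ℕ) :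
    ((b.algorithm start).config (c, ⟨P.init, b.init_mem⟩) L k).2.map
      (b.algorithm start).decode = (P.run c L k).2.map P.decode :=
  (List.map_map (f := Subtype.val) (g := P.decode)).symm.trans
    (congrArg (List.map P.decode) (b.config_algorithm start c L k).2.2)

end StreamProgram

/-! ### Simultaneous searches from centres, and the tree of shortest chains. -/

section Trees

variable {V X : Type} [DecidableEq V]

/-- The distance bound recorded for the vertex `k.1` and the centre `k.2`; a centre has
distance `0` from itself. -/
def centreLevel (ctr : X → V) (c : V × X → Option (ℕ × V)) (k : V × X) : Option ℕ :=
  if k.1 = ctr k.2 then some 0 else (c k).map Prod.fst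

/-- Every recorded bound is justified by the bound of the recorded predecessor. -/
def Supported (G : SimpleGraph V) (ρ : Sym2 V → ℕ) (ctr : X → V)
    (c : V × X → Option (ℕ × V)) : Prop :=
  ∀ v x l p, c (v, x) = some (l, p) → v ≠ ctr x ∧ G.Adj p v ∧
    ∃ l', centreLevel ctr c (p, x) = some l' ∧ l' + ρ s(p, v) ≤ l

/-- The state of a breadth-first search from all centres when the levels below `D` are complete. -/
structure SearchInv (G : SimpleGraph V) (ρ : Sym2 V → ℕ) (ctr : X → V)
    (c : V × X → Option (ℕ × V)) (D : ℕ) : Prop where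
  supported : Supported G ρ ctr c
  le : ∀ k l p, c k = some (l, p) → l ≤ D
  closed : ∀ u v x l, G.Adj u v → centreLevel ctr c (u, x) = some l → l + ρ s(u, v) < D →
    ∃ l', centreLevel ctr c (v, x) = some l' ∧ l' ≤ l + ρ s(u, v)

/-- `(v, x)` can be given level `D` via the neighbour `u`. -/
def Eligible (ρ : Sym2 V → ℕ) (ctr : X → V) (c : V × X → Option (ℕ × V)) (D : ℕ)
    (u v : V) (x : X) : Prop :=
  v ≠ ctr x ∧ c (v, x) = none ∧ ∃ l, centreLevel ctr c (u, x) = some l ∧ l + ρ s(u, v) ≤ D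

variable {G : SimpleGraph V} {ρ : Sym2 V → ℕ} {ctr : X → V}
  {c c' : V × X → Option (ℕ × V)} {D D' : ℕ}

lemma centreLevel_self (x : X) : centreLevel ctr c (ctr x, x) = some 0 := by simp [centreLevel]

lemma centreLevel_mono (h : ∀ k i, c k = some i → c' k = some i) {k : V × X} {l : ℕ}
    (hk : centreLevel ctr c k = some l) : centreLevel ctr c' k = some l := by
  unfold centreLevel at hk ⊢
  split_ifs with h1
  · simpa [h1] using hk
  · rw [if_neg h1, Option.map_eq_some_iff] at hk
    obtain ⟨i, hi, rfl⟩ := hk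
    simp [h _ _ hi]

/-- Weights are at least `1`, so closure below level `1` demands nothing. This is why every search
starts with level `1`. -/
lemma searchInv_none (h : ∀ e, 1 ≤ ρ e) : SearchInv G ρ ctr (fun _ => none) 1 where
  supported := by simp [Supported]
  le := by simp
  closed := by
    intro u v x l _ _ hl
    have := h s(u, v)
    omega

/-- One pass either enters some pairs at level `D` and stays there, or enters all eligible ones and
moves on. Entries of level `D` cannot disturb closure below `D + 1`, since an edge from them leads
to `D + 1` or beyond. -/
lemma SearchInv.step (H : SearchInv G ρ ctr c D) (hρ : ∀ e, 1 ≤ ρ e)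
    (ext : ∀ k i, c k = some i → c' k = some i)
    (new : ∀ v x l p, c (v, x) = none → c' (v, x) = some (l, p) →
      l = D ∧ G.Adj p v ∧ Eligible ρ ctr c D p v x)
    (hD : D' = D ∨ D' = D + 1 ∧
      ∀ u v x, G.Adj u v → Eligible ρ ctr c D u v x → c' (v, x) ≠ none) :
    SearchInv G ρ ctr c' D' := by
  have old : ∀ k i, c' k = some i → c k = some i ∨ c k = none := by
    intro k i hi
    rcases hc : c k with _ | j
    · exact Or.inr rfl
    · left; rw [← hi, ext _ _ hc]
  have hle : ∀ k l p, c' k = some (l, p) → l ≤ D := by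
    rintro ⟨v, x⟩ l p h
    rcases old _ _ h with h' | h'
    · exact H.le _ _ _ h'
    · exact (new _ _ _ _ h' h).1.le
  refine ⟨?_, ?_, ?_⟩
  · intro v x l p h
    rcases old _ _ h with h' | h'
    · obtain ⟨h1, h2, l', h3, h4⟩ := H.supported _ _ _ _ h'
      exact ⟨h1, h2, l', centreLevel_mono ext h3, h4⟩
    · obtain ⟨rfl, h2, h1, -, l', h3, h4⟩ := new _ _ _ _ h' h
      exact ⟨h1, h2, l', centreLevel_mono ext h3, h4⟩
  · intro k l p h
    have := hle k l p h
    omega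
  · intro u v x l huv hl hlt
    have hpos := hρ s(u, v)
    have hlu : centreLevel ctr c (u, x) = some l := by
      unfold centreLevel at hl ⊢
      split_ifs with h1
      · rwa [if_pos h1] at hl
      · rw [if_neg h1, Option.map_eq_some_iff] at hl
        obtain ⟨⟨l', p⟩, hi, rfl⟩ := hl
        rcases old _ _ hi with h' | h'
        · simp [h']
        -- A newly entered `u` has level `D`, so `l + ρ s(u, v)` is at least `D + 1`, contrary to
        -- `hlt`.
        · have := (new _ _ _ _ h' hi).1
          simp only at hlt
          omega
    by_cases hlt' : l + ρ s(u, v) < D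
    · obtain ⟨l', h1, h2⟩ := H.closed u v x l huv hlu hlt'
      exact ⟨l', centreLevel_mono ext h1, h2⟩
    · rcases hD with rfl | ⟨rfl, hall⟩
      · exact absurd hlt hlt'
      by_cases hv : v = ctr x
      · exact ⟨0, by rw [hv, centreLevel_self], Nat.zero_le _⟩
      have hne : c' (v, x) ≠ none := by
        rcases hc : c (v, x) with _ | i
        · exact hall u v x huv ⟨hv, hc, l, hlu, by omega⟩
        · rw [ext _ _ hc]; simp
      obtain ⟨⟨l', p⟩, hi⟩ := Option.ne_none_iff_exists'.mp hne
      have := hle _ _ _ hi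
      exact ⟨l', by simp [centreLevel, hv, hi], by omega⟩

/-- Along every chain of edges of `ρ`-length at most `R` that starts at a centre, the recorded
bound is at most `U` times the `ρ`-length. -/
def ChainBound (G : SimpleGraph V) (ρ : Sym2 V → ℕ) (U R : ℕ) (ctr : X → V)
    (c : V × X → Option (ℕ × V)) : Prop :=
  ∀ (x : X) (p : ℕ → V) (m : ℕ), p 0 = ctr x → (∀ t < m, G.Adj (p t) (p (t + 1))) →
    ∑ t ∈ Finset.range m, ρ s(p t, p (t + 1)) ≤ R →
    ∃ e, centreLevel ctr c (p m, x) = some e ∧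
      e ≤ U * ∑ t ∈ Finset.range m, ρ s(p t, p (t + 1))

/-- All prefixes of the chain have length at most `R < D`, so `closed` applies at each edge. -/
lemma SearchInv.chainBound (H : SearchInv G ρ ctr c D) {R : ℕ} (hR : R < D) :
    ChainBound G ρ 1 R ctr c := by
  intro x p m h0 hadj
  induction m with
  | zero => intro _; exact ⟨0, by rw [h0, centreLevel_self], Nat.zero_le _⟩
  | succ m ih =>
    intro hs
    rw [Finset.sum_range_succ] at hs ⊢
    obtain ⟨e, he, hle⟩ := ih (fun t ht => hadj t (by omega)) (by omega)
    obtain ⟨l', h1, h2⟩ := H.closed _ _ x e (hadj m (by omega)) he (by omega)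
    exact ⟨l', h1, by omega⟩

/-- The one of two optional elements that has the smaller value of `φ`. -/
def optMin {γ : Type} (φ : γ → ℕ) : Option γ → Option γ → Option γ
  | none, b => b
  | some a, none => some a
  | some a, some b => if φ b < φ a then some b else some a

lemma optMin_eq_some {γ : Type} {φ : γ → ℕ} {a b : Option γ} {i : γ}
    (h : optMin φ a b = some i) : a = some i ∨ b = some i := by
  rcases a with _ | a <;> rcases b with _ | b <;> simp only [optMin] at h
  · simp at h
  · exact Or.inr h
  · exact Or.inl h
  · split_ifs at h
    · exact Or.inr h
    · exact Or.inl h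

lemma optMin_le_left {γ : Type} {φ : γ → ℕ} {b : Option γ} (i : γ) :
    ∃ j, optMin φ (some i) b = some j ∧ φ j ≤ φ i := by
  rcases b with _ | b <;> simp only [optMin]
  · exact ⟨i, rfl, le_rfl⟩
  · split_ifs with h
    · exact ⟨b, rfl, h.le⟩
    · exact ⟨i, rfl, le_rfl⟩

lemma optMin_le_right {γ : Type} {φ : γ → ℕ} {a : Option γ} (i : γ) :
    ∃ j, optMin φ a (some i) = some j ∧ φ j ≤ φ i := by
  rcases a with _ | a <;> simp only [optMin]
  · exact ⟨i, rfl, le_rfl⟩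
  · split_ifs with h
    · exact ⟨i, rfl, le_rfl⟩
    · exact ⟨a, rfl, not_lt.mp h⟩

/-- The bounds `best` improved by the bounds that a search with unit `U` has found. -/
def improve (U : ℕ) (best c : Option (ℕ × V)) : Option (ℕ × V) :=
  optMin Prod.fst best (c.map fun i => (U * i.1, i.2))

lemma centreLevel_le_of {b b' : V × X → Option (ℕ × V)} {U : ℕ}
    (h : ∀ k i, b k = some i → ∃ j, b' k = some j ∧ j.1 ≤ U * i.1) {k : V × X} {l : ℕ}
    (hk : centreLevel ctr b k = some l) : ∃ l', centreLevel ctr b' k = some l' ∧ l' ≤ U * l := by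
  unfold centreLevel at hk ⊢
  split_ifs with h1
  · exact ⟨0, rfl, Nat.zero_le _⟩
  · rw [if_neg h1, Option.map_eq_some_iff] at hk
    obtain ⟨i, hi, rfl⟩ := hk
    obtain ⟨j, hj, hle⟩ := h _ _ hi
    exact ⟨j.1, by simp [hj], hle⟩

variable {best : V × X → Option (ℕ × V)} {U R : ℕ} {ω : Sym2 V → ℕ}

omit [DecidableEq V] in
lemma improve_le_best (k : V × X) (i : ℕ × V) (h : best k = some i) :
    ∃ j, improve U (best k) (c k) = some j ∧ j.1 ≤ 1 * i.1 := by
  rw [h, one_mul]; exact optMin_le_left i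

omit [DecidableEq V] in
lemma improve_le_search (k : V × X) (i : ℕ × V) (h : c k = some i) :
    ∃ j, improve U (best k) (c k) = some j ∧ j.1 ≤ U * i.1 := by
  rw [h]; exact optMin_le_right (φ := Prod.fst) (U * i.1, i.2)

/-- Improvement only lowers bounds, so a bound justified by its predecessor stays justified when the
predecessor improves. For entries of the new search, multiplying the inequality for `ρ` by `U` gives
the one for `ω`, because `ω ≤ U * ρ`. -/
lemma Supported.improve (hb : Supported G ω ctr best) (hc : Supported G ρ ctr c)
    (hω : ∀ e, ω e ≤ U * ρ e) :
    Supported G ω ctr fun k => improve U (best k) (c k) := by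
  intro v x l p h
  rcases optMin_eq_some h with h | h
  · obtain ⟨h1, h2, l', h3, h4⟩ := hb _ _ _ _ h
    obtain ⟨l'', h5, h6⟩ := centreLevel_le_of (ctr := ctr)
      (improve_le_best (U := U) (c := c) (best := best)) h3
    exact ⟨h1, h2, l'', h5, by omega⟩
  · rw [Option.map_eq_some_iff] at h
    obtain ⟨⟨l0, p0⟩, hc0, he⟩ := h
    obtain ⟨rfl, rfl⟩ := Prod.mk.inj he
    obtain ⟨h1, h2, l', h3, h4⟩ := hc _ _ _ _ hc0
    obtain ⟨l'', h5, h6⟩ := centreLevel_le_of (ctr := ctr)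
      (improve_le_search (U := U) (c := c) (best := best)) h3
    refine ⟨h1, h2, l'', h5, ?_⟩
    have := hω s(p0, v)
    have := Nat.mul_le_mul_left U h4
    simp only at this ⊢
    nlinarith

lemma ChainBound.improve_best (h : ChainBound G ρ U R ctr best) (U' : ℕ) :
    ChainBound G ρ U R ctr fun k => improve U' (best k) (c k) := by
  intro x p m h0 hadj hs
  obtain ⟨e, h1, h2⟩ := h x p m h0 hadj hs
  obtain ⟨l, h3, h4⟩ := centreLevel_le_of (ctr := ctr)
      (improve_le_best (U := U') (c := c) (best := best)) h1
  exact ⟨l, h3, by omega⟩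

lemma ChainBound.improve_search (h : ChainBound G ρ 1 R ctr c) :
    ChainBound G ρ U R ctr fun k => improve U (best k) (c k) := by
  intro x p m h0 hadj hs
  obtain ⟨e, h1, h2⟩ := h x p m h0 hadj hs
  obtain ⟨l, h3, h4⟩ := centreLevel_le_of (ctr := ctr)
      (improve_le_search (U := U) (c := c) (best := best)) h1
  exact ⟨l, h3, h4.trans (Nat.mul_le_mul_left _ (by omega))⟩

/-- `d` is the length of a chain of recorded segments that leads from `s` to the vertex. -/
inductive ChainValue (ctr : X → V) (s : V) (b : V × X → Option (ℕ × V)) : V → ℕ → Prop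
  | source : ChainValue ctr s b s 0
  | step {x : X} {d : ℕ} {v : V} {e : ℕ} {p : V} (h : ChainValue ctr s b (ctr x) d)
      (hb : b (v, x) = some (e, p)) : ChainValue ctr s b v (d + e)

lemma ChainValue.extend {s v : V} {x : X} {d e : ℕ} (h : ChainValue ctr s best (ctr x) d)
    (hb : centreLevel ctr best (v, x) = some e) : ChainValue ctr s best v (d + e) := by
  unfold centreLevel at hb
  split_ifs at hb with h1
  · obtain rfl := Option.some.inj hb
    simp only at h1
    exact h1 ▸ h
  · rw [Option.map_eq_some_iff] at hb
    obtain ⟨i, hi, rfl⟩ := hb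
    exact .step h hi

/-- `pr` chooses for every vertex the predecessor in a shortest chain of recorded segments. -/
structure IsChoice (ctr : X → V) (s : V) (b : V × X → Option (ℕ × V)) (pr : V → Option V) :
    Prop where
  minimal : ∀ v p, pr v = some p → v ≠ s ∧ ∃ x d e, ChainValue ctr s b (ctr x) d ∧
    b (v, x) = some (e, p) ∧ ∀ d', ChainValue ctr s b v d' → d + e ≤ d'
  exists_pred : ∀ v d, v ≠ s → ChainValue ctr s b v d → pr v ≠ none

omit [DecidableEq V] in
lemma walkLength_concat {w : Sym2 V → ℕ} {u v z : V} (P : G.Walk u v) (h : G.Adj v z) :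
    walkLength w (P.concat h) = walkLength w P + w s(v, z) := by
  simp [walkLength, SimpleGraph.Walk.edges_concat]

/-- The predecessor `p` of `v` has a chain value `d0 + l` smaller than the minimum `d0 + e` for `v`
by at least the weight of the edge, so strong induction on the value reaches `s`. The claim on the
support makes the walk a path: all vertices of the walk to `p` have values below the least value of
`v`, so `v` is not among them. -/
lemma IsChoice.exists_path {s : V} {pr : V → Option V} (H : IsChoice ctr s best pr)
    (hb : Supported G ω ctr best) (hω : ∀ e, 1 ≤ ω e) (d : ℕ) (v : V)
    (hv : ChainValue ctr s best v d) :
    ∃ P : G.Walk s v, P.IsPath ∧ (∀ a ∈ P.darts, pr a.snd = some a.fst) ∧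
      walkLength ω P ≤ d ∧ ∀ y ∈ P.support, ∃ d' ≤ d, ChainValue ctr s best y d' := by
  induction d using Nat.strong_induction_on generalizing v with
  | _ d ih =>
    by_cases hs : v = s
    · subst hs
      exact ⟨.nil, by simp, by simp, by simp [walkLength], by simpa using ⟨d, le_rfl, hv⟩⟩
    · obtain ⟨p, hp⟩ := Option.ne_none_iff_exists'.mp (H.exists_pred v d hs hv)
      obtain ⟨-, x, d0, e, h0, hbv, hmin⟩ := H.minimal v p hp
      obtain ⟨-, hadj, l, hl, hle⟩ := hb _ _ _ _ hbv
      have hpos := hω s(p, v)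
      have hd := hmin d hv
      obtain ⟨P, hP, hdarts, hlen, hsup⟩ := ih (d0 + l) (by omega) p (h0.extend hl)
      refine ⟨P.concat hadj, hP.concat ?_ hadj, ?_, ?_, ?_⟩
      · intro hmem
        obtain ⟨d', hd', hc⟩ := hsup v hmem
        have := hmin d' hc
        omega
      · intro a ha
        rw [SimpleGraph.Walk.darts_concat, List.concat_eq_append, List.mem_append,
          List.mem_singleton] at ha
        rcases ha with ha | rfl
        · exact hdarts a ha
        · exact hp
      · rw [walkLength_concat]; omega
      · intro y hy
        rw [SimpleGraph.Walk.support_concat, List.mem_append,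
          List.mem_singleton] at hy
        rcases hy with hy | rfl
        · obtain ⟨d', hd', hc⟩ := hsup y hy
          exact ⟨d', by omega, hc⟩
        · exact ⟨d, le_rfl, hv⟩

end Trees

/-! ### Rounding of weights and the approximation guarantee. -/

section Approximation

/-- The rounded weight of an edge of weight `w` at a scale. Scale `0` serves the segments of
length `0`, and scale `i + 1` those of length between `2 ^ (i - 1)` and `2 ^ i`. -/
def scaleWeight (B h E : ℕ) : ℕ → ℕ → ℕ
  | 0, w => B * (h * E) * w + 1
  | i + 1, w => w * (h * E) / 2 ^ i + 1

/-- The value of one unit of rounded weight. -/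
def scaleUnit (B : ℕ) : ℕ → ℕ
  | 0 => 1
  | i + 1 => B * 2 ^ i

lemma one_le_scaleWeight (B h E σ w : ℕ) : 1 ≤ scaleWeight B h E σ w := by
  cases σ <;> simp [scaleWeight]

/-- The quotient plus one strictly exceeds the exact quotient, and a strict inequality of integers
multiplied by `B ≥ 1` leaves room for the `+ 1`. Thus predecessors found at any scale are justified
for the one common weight. -/
lemma le_scaleUnit_mul_scaleWeight {B : ℕ} (hB : 1 ≤ B) (h E σ w : ℕ) :
    B * (h * E) * w + 1 ≤ scaleUnit B σ * scaleWeight B h E σ w := by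
  cases σ with
  | zero => simp [scaleUnit, scaleWeight]
  | succ i =>
    have h1 := Nat.lt_mul_div_succ (w * (h * E)) (Nat.two_pow_pos i)
    have h2 := Nat.mul_lt_mul_of_pos_left h1 (by omega : 0 < B)
    simp only [scaleUnit, scaleWeight]
    rw [mul_assoc B (2 ^ i)]
    calc _ = B * (w * (h * E)) + 1 := by ring
      _ ≤ _ := h2

lemma two_pow_clog_le {l : ℕ} (hl : 1 ≤ l) : 2 ^ Nat.clog 2 l ≤ 2 * l := by
  rcases Nat.lt_or_ge 1 l with hl1 | hl1
  · have := Nat.pow_pred_clog_lt_self (b := 2) (by norm_num) hl1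
    have hi1 : 1 ≤ Nat.clog 2 l := Nat.clog_pos (by norm_num) hl1
    obtain ⟨j, hj⟩ : ∃ j, Nat.clog 2 l = j + 1 := ⟨Nat.clog 2 l - 1, by omega⟩
    rw [hj] at this
    rw [hj, pow_succ]
    simp only [Nat.pred_eq_sub_one, Nat.add_sub_cancel] at this
    omega
  · obtain rfl : l = 1 := by omega
    simp

variable {V X : Type} [DecidableEq V] {G : SimpleGraph V} {ctr : X → V}
  {best : V × X → Option (ℕ × V)} {w : Sym2 V → ℕ} {B h E W : ℕ}

/-- The recorded bounds are good at all the scales that matter for total weight `W`. -/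
def ScalesDone (G : SimpleGraph V) (w : Sym2 V → ℕ) (B h E : ℕ) (ctr : X → V)
    (best : V × X → Option (ℕ × V)) (N : ℕ) : Prop :=
  ∀ σ < N, ChainBound G (fun e => scaleWeight B h E σ (w e)) (scaleUnit B σ) (h * E + h) ctr best

/-- For length `l > 0` use the scale `i + 1` with `l ≤ 2 ^ i ≤ 2 * l`. The quotients sum to `F ≤ h *
E`, so the segment lies within the radius; the `m ≤ h` extra units cost at most `B * 2 ^ i * h ≤ 2 *
B * h * l`. For `l = 0` this scale is unavailable, and scale `0` gives the bound `m ≤ h`, which is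
the additive term. -/
lemma ScalesDone.segment (H : ScalesDone G w B h E ctr best (Nat.clog 2 W + 2))
    {x : X} {p : ℕ → V} {m : ℕ} (h0 : p 0 = ctr x) (hadj : ∀ t < m, G.Adj (p t) (p (t + 1)))
    (hm : m ≤ h) (hW : ∑ t ∈ Finset.range m, w s(p t, p (t + 1)) ≤ W) :
    ∃ e, centreLevel ctr best (p m, x) = some e ∧
      e ≤ B * h * (E + 2) * ∑ t ∈ Finset.range m, w s(p t, p (t + 1)) + h := by
  set l := ∑ t ∈ Finset.range m, w s(p t, p (t + 1)) with hl
  rcases Nat.eq_zero_or_pos l with hz | hpos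
  · have hsum : ∑ t ∈ Finset.range m, scaleWeight B h E 0 (w s(p t, p (t + 1))) = m := by
      simp [scaleWeight, Finset.sum_add_distrib, ← Finset.mul_sum, ← hl, hz]
    obtain ⟨e, he, hle⟩ := H 0 (by omega) x p m h0 hadj (by rw [hsum]; nlinarith)
    rw [hsum] at hle
    exact ⟨e, he, by simp only [scaleUnit] at hle; omega⟩
  · set i := Nat.clog 2 l with hi
    have h1 : l ≤ 2 ^ i := Nat.le_pow_clog (by norm_num) l
    have h2 : 2 ^ i ≤ 2 * l := two_pow_clog_le hpos
    have hiW : i ≤ Nat.clog 2 W := Nat.clog_mono_right 2 hW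
    set F := ∑ t ∈ Finset.range m, w s(p t, p (t + 1)) * (h * E) / 2 ^ i with hF
    have hsum : ∑ t ∈ Finset.range m, scaleWeight B h E (i + 1) (w s(p t, p (t + 1))) =
        F + m := by
      simp [scaleWeight, Finset.sum_add_distrib, hF]
    have hFl : 2 ^ i * F ≤ l * (h * E) := by
      rw [hF, hl, Finset.mul_sum, Finset.sum_mul]
      exact Finset.sum_le_sum fun t _ => Nat.mul_div_le _ _
    have hFle : F ≤ h * E := by
      have : 2 ^ i * F ≤ 2 ^ i * (h * E) := hFl.trans (Nat.mul_le_mul_right _ h1)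
      exact Nat.le_of_mul_le_mul_left this (Nat.two_pow_pos i)
    obtain ⟨e, he, hle⟩ := H (i + 1) (by omega) x p m h0 hadj (by rw [hsum]; omega)
    rw [hsum] at hle
    refine ⟨e, he, hle.trans ?_⟩
    have h3 : 2 ^ i * m ≤ 2 * l * h := Nat.mul_le_mul h2 hm
    calc scaleUnit B (i + 1) * (F + m) = B * (2 ^ i * F + 2 ^ i * m) := by
          simp only [scaleUnit]; ring
      _ ≤ B * (l * (h * E) + 2 * l * h) := by gcongr
      _ = B * h * (E + 2) * l := by ring
      _ ≤ _ := Nat.le_add_right _ _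

/-- Among any `h` consecutive vertices of the chain `p 0, …, p len` there is a centre. -/
def HitsChain (ctr : X → V) (h : ℕ) (p : ℕ → V) (len : ℕ) : Prop :=
  ∀ i, i + h ≤ len → ∃ x, ∃ t, i ≤ t ∧ t < i + h ∧ ctr x = p t

/-- Step back from position `j` to a centre at most `h` edges earlier, and append the segment from
there to a chain given by induction. -/
lemma ScalesDone.exists_chainValue (H : ScalesDone G w B h E ctr best (Nat.clog 2 W + 2))
    (x₀ : X) {p : ℕ → V} {len : ℕ} (h0 : p 0 = ctr x₀)
    (hadj : ∀ t < len, G.Adj (p t) (p (t + 1))) (hit : HitsChain ctr h p len)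
    (hW : ∑ t ∈ Finset.range len, w s(p t, p (t + 1)) ≤ W) (j : ℕ) (hj : j ≤ len) :
    ∃ d, ChainValue ctr (ctr x₀) best (p j) d ∧
      d ≤ B * h * (E + 2) * ∑ t ∈ Finset.range j, w s(p t, p (t + 1)) + h * j := by
  induction j using Nat.strong_induction_on with
  | _ j ih =>
    rcases Nat.eq_zero_or_pos j with rfl | hpos
    · exact ⟨0, h0 ▸ .source, Nat.zero_le _⟩
    obtain ⟨i, x, hij, hjh, hx⟩ : ∃ i x, i < j ∧ j ≤ i + h ∧ p i = ctr x := by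
      rcases le_or_gt j h with hjh | hjh
      · exact ⟨0, x₀, hpos, by omega, h0⟩
      -- The window consists of the positions `j - h, …, j - 1`, so the centre lies strictly before
      -- `j` and the segment is nonempty.
      · obtain ⟨x, t, h1, h2, h3⟩ := hit (j - h) (by omega)
        exact ⟨t, x, by omega, by omega, h3.symm⟩
    obtain ⟨m, rfl⟩ : ∃ m, j = i + m := ⟨j - i, by omega⟩
    obtain ⟨d, hd, hdle⟩ := ih i hij (by omega)
    have hsplit := Finset.sum_range_add (fun t => w s(p t, p (t + 1))) i m
    have hmono : ∑ t ∈ Finset.range (i + m), w s(p t, p (t + 1)) ≤ W :=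
      (Finset.sum_le_sum_of_subset (Finset.range_mono hj)).trans hW
    obtain ⟨e, he, hele⟩ := H.segment (x := x) (p := fun t => p (i + t)) (m := m) hx
      (fun t ht => hadj (i + t) (by omega)) (by omega)
      (by simp only [← add_assoc]; omega)
    refine ⟨d + e, (hx ▸ hd : ChainValue ctr _ best (ctr x) d).extend he, ?_⟩
    simp only [← add_assoc] at hele
    rw [hsplit, mul_add (B * h * (E + 2)), mul_add h]
    -- The segment has at least one edge, so its additive error `h` is covered by the term `h * j`.
    have : h * 1 ≤ h * m := Nat.mul_le_mul_left h (by omega)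
    omega

omit [DecidableEq V] in
lemma walkLength_eq_sum {u v : V} (P : G.Walk u v) :
    walkLength w P = ∑ t ∈ Finset.range P.length, w s(P.getVert t, P.getVert (t + 1)) := by
  induction P with
  | nil => simp [walkLength]
  | cons hadj P ih =>
    rw [SimpleGraph.Walk.length_cons, Finset.sum_range_succ']
    simp only [SimpleGraph.Walk.getVert_cons_succ, SimpleGraph.Walk.getVert_zero, zero_add]
    rw [← ih]
    simp [walkLength, add_comm]

omit [DecidableEq V] in
lemma walkLength_le_totalWeight [Fintype V] {u v : V} {P : G.Walk u v} (hP : P.IsPath) :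
    walkLength w P ≤ totalWeight G w := by
  classical
  have h1 : walkLength w P = ∑ e ∈ P.edges.toFinset, w e := by
    rw [List.sum_toFinset _ hP.isTrail.edges_nodup, walkLength]
  rw [h1, totalWeight]
  refine Finset.sum_le_sum_of_subset fun e he => ?_
  rw [List.mem_toFinset] at he
  simpa using P.edges_subset_edgeSet he

omit [DecidableEq V] in
lemma mul_walkLength_le (a : ℕ) {u v : V} (P : G.Walk u v) :
    a * walkLength w P ≤ walkLength (fun e => a * w e + 1) P := by
  unfold walkLength
  induction P.edges with
  | nil => simp
  | cons e l ih =>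
    simp only [List.map_cons, List.sum_cons, mul_add]
    omega

omit [DecidableEq V] in
lemma exists_shortest_path {s v : V} (hv : G.Reachable s v) (w : Sym2 V → ℕ) :
    ∃ P : G.Walk s v, P.IsPath ∧ ∀ Q : G.Walk s v, Q.IsPath → walkLength w P ≤ walkLength w Q := by
  classical
  obtain ⟨P₀⟩ := hv
  have hex : ∃ k, ∃ P : G.Walk s v, P.IsPath ∧ walkLength w P = k :=
    ⟨_, P₀.bypass, P₀.bypass_isPath, rfl⟩
  obtain ⟨P, hP, hk⟩ := Nat.find_spec hex
  exact ⟨P, hP, fun Q hQ => hk ▸ Nat.find_min' hex ⟨Q, hQ, rfl⟩⟩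

/-- A path `P` with value at most `d` satisfies `B * h * E * walkLength w P ≤ d`, while `d < B * h *
((E + 2) * walkLength w Q + 1)`, because a path has fewer than `B` edges. Cancelling `B * h` and
using integrality leaves the pure factor `(E + 2) / E`. The precision hypothesis concerns only `d ≤
totalWeight G w`, which permits a cap on `E` when `ε` is tiny. -/
lemma representsApproxShortestPaths [Fintype V] {ε : ℝ} {x₀ : X} {pr : V → Option V}
    {out : List (V × V)} (hB : Fintype.card V ≤ B) (hh : 1 ≤ h)
    (hε : ∀ a d : ℕ, d ≤ totalWeight G w → E * a ≤ (E + 2) * d → (a : ℝ) ≤ (1 + ε) * d)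
    (H : ScalesDone G w B h E ctr best (Nat.clog 2 (totalWeight G w) + 2))
    (hsup : Supported G (fun e => B * (h * E) * w e + 1) ctr best)
    (hpr : IsChoice ctr (ctr x₀) best pr)
    (hit : ∀ v, G.Reachable (ctr x₀) v → ∃ P : G.Walk (ctr x₀) v, P.IsPath ∧
      (∀ Q : G.Walk (ctr x₀) v, Q.IsPath → walkLength w P ≤ walkLength w Q) ∧
      HitsChain ctr h P.getVert P.length)
    (hnodup : (out.map Prod.fst).Nodup) (hout : ∀ v p, (v, p) ∈ out ↔ pr v = some p) :
    RepresentsApproxShortestPaths G w ε (ctr x₀) out := by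
  have key : ∀ v, G.Reachable (ctr x₀) v → ∃ d, ChainValue ctr (ctr x₀) best v d ∧
      ∀ Q : G.Walk (ctr x₀) v, Q.IsPath →
        d < B * h * ((E + 2) * walkLength w Q + 1) ∧ walkLength w Q ≤ totalWeight G w := by
    intro v hv
    obtain ⟨P, hP, hmin, hhit⟩ := hit v hv
    have hW := walkLength_le_totalWeight (w := w) hP
    rw [walkLength_eq_sum] at hW
    obtain ⟨d, hd, hdle⟩ := H.exists_chainValue x₀ (p := P.getVert) (by simp)
      (fun t ht => P.adj_getVert_succ ht) hhit hW P.length le_rfl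
    rw [P.getVert_length] at hd
    refine ⟨d, hd, fun Q hQ => ⟨hdle.trans_lt ?_, walkLength_le_totalWeight hQ⟩⟩
    rw [← walkLength_eq_sum]
    have h1 := hmin Q hQ
    have h2 : P.length < B := hP.length_lt.trans_le hB
    have h3 : h * P.length < h * B := Nat.mul_lt_mul_of_pos_left h2 hh
    have h4 : B * h * (E + 2) * walkLength w P ≤ B * h * (E + 2) * walkLength w Q :=
      Nat.mul_le_mul_left _ h1
    calc _ < B * h * (E + 2) * walkLength w Q + h * B := by omega
      _ = _ := by ring
  have hpos : 0 < B * h := Nat.mul_pos (lt_of_lt_of_le (Fintype.card_pos_iff.mpr ⟨ctr x₀⟩) hB) hh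
  refine ⟨hnodup, fun v => ?_, fun v hv => ?_⟩
  · rw [List.mem_map]
    constructor
    · rintro ⟨⟨v', p⟩, hmem, rfl⟩
      obtain ⟨hne, x, d, e, hd, hb, -⟩ := hpr.minimal _ _ ((hout _ _).mp hmem)
      obtain ⟨P, -⟩ := hpr.exists_path hsup (fun _ => by omega) _ _ (hd.step hb)
      exact ⟨hne, ⟨P⟩⟩
    · rintro ⟨hne, hv⟩
      obtain ⟨d, hd, -⟩ := key v hv
      obtain ⟨p, hp⟩ := Option.ne_none_iff_exists'.mp (hpr.exists_pred v d hne hd)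
      exact ⟨(v, p), (hout _ _).mpr hp, rfl⟩
  · obtain ⟨d, hd, hlt⟩ := key v hv
    obtain ⟨P, hP, hdarts, hlen, -⟩ := hpr.exists_path hsup (fun _ => by omega) d v hd
    refine ⟨P, fun a ha => (hout _ _).mpr (hdarts a ha), hP, fun Q hQ => ?_⟩
    obtain ⟨h1, h2⟩ := hlt Q hQ
    refine hε _ _ h2 ?_
    have h3 : B * h * (E * walkLength w P) < B * h * ((E + 2) * walkLength w Q + 1) := by
      calc B * h * (E * walkLength w P) = B * (h * E) * walkLength w P := by ring
        _ ≤ _ := mul_walkLength_le _ P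
        _ ≤ d := hlen
        _ < _ := h1
    exact Nat.lt_succ_iff.mp (Nat.lt_of_mul_lt_mul_left h3)

end Approximation

/-! ### Random centres on shortest paths. -/

section Sampling

open Finset

/-- The number of samples of size `K` that avoid a set. -/
lemma card_avoiding {V : Type} [Fintype V] [DecidableEq V] (K : ℕ) (S : Finset V) :
    #{f : Fin K → V | ∀ i, f i ∉ S} = (Fintype.card V - #S) ^ K := by
  have : ({f : Fin K → V | ∀ i, f i ∉ S} : Finset _) = Fintype.piFinset fun _ : Fin K => Sᶜ := by
    ext f; simp
  rw [this, Fintype.card_piFinset_const, card_compl]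

/-- The estimate is `(1 - h / n) ^ K ≤ exp (-(h * K / n))`, followed by the lower bound on `h * K`.
-/
lemma avoiding_ratio_le {n h K : ℕ} {β : ℝ} (hn : 2 ≤ n)
    (hK : β * n * Real.log n ≤ h * K) :
    ((n - h : ℕ) : ℝ) ^ K ≤ (n : ℝ) ^ K * (n : ℝ) ^ (-β) := by
  have hn0 : (0 : ℝ) < n := by positivity
  -- For `n ≤ h` the truncated difference is `0`. Its power is still `1` when `K = 0`, but then the
  -- hypothesis forces `β ≤ 0`.
  rcases le_or_gt n h with hnh | hnh
  · rw [Nat.sub_eq_zero_of_le hnh]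
    rcases Nat.eq_zero_or_pos K with rfl | hKpos
    · have hl : 0 < Real.log n := Real.log_pos (by exact_mod_cast hn)
      have hb : β ≤ 0 := by
        by_contra hb
        push Not at hb
        have : 0 < β * n * Real.log n := by positivity
        simp at hK
        linarith
      simpa using Real.one_le_rpow (by exact_mod_cast (by omega : 1 ≤ n)) (by linarith)
    · rw [Nat.cast_zero, zero_pow hKpos.ne']
      positivity
  · rw [Nat.cast_sub hnh.le]
    have h1 : (n : ℝ) - h = n * (1 - h / n) := by field_simp
    have h2 : (1 : ℝ) - h / n ≤ Real.exp (-(h / n)) := by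
      have := Real.add_one_le_exp (-((h : ℝ) / n)); linarith
    have h3 : (0 : ℝ) ≤ 1 - h / n := by
      rw [sub_nonneg, div_le_one hn0]; exact_mod_cast hnh.le
    rw [h1, mul_pow]
    refine mul_le_mul_of_nonneg_left ?_ (by positivity)
    calc (1 - (h : ℝ) / n) ^ K ≤ Real.exp (-(h / n)) ^ K := pow_le_pow_left₀ h3 h2 K
      _ = Real.exp (-(h * K / n)) := by rw [← Real.exp_nat_mul]; congr 1; ring
      _ ≤ Real.exp (Real.log n * -β) := by
        rw [Real.exp_le_exp]
        have : β * Real.log n ≤ h * K / n := by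
          rw [le_div_iff₀ hn0]; linarith
        linarith
      _ = (n : ℝ) ^ (-β) := by rw [Real.rpow_def_of_pos hn0]

/-- A sample of `K` of the `n` vertices meets, with high probability, each of a family of at most
`n ^ 2` sets of size `h`. -/
lemma sample_hits_all {n h K : ℕ} {α : ℝ} (hn : 2 ≤ n)
    (hK : (α + 1) * n * Real.log n ≤ h * K) {ι : Type} (I : Finset ι) (hI : #I ≤ n ^ 2)
    (S : ι → Finset (Fin n)) (hS : ∀ i ∈ I, #(S i) = h) :
    (n : ℝ) ^ K - #{f : Fin K → Fin n | ∀ i ∈ I, ∃ k, f k ∈ S i} ≤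
      (n : ℝ) ^ K * (1 / (n : ℝ) ^ (α - 1)) := by
  classical
  have hn0 : (0 : ℝ) < n := by positivity
  have h1 := card_filter_add_card_filter_not (s := (univ : Finset (Fin K → Fin n)))
    fun f => ∀ i ∈ I, ∃ k, f k ∈ S i
  rw [card_univ, Fintype.card_fun, Fintype.card_fin, Fintype.card_fin] at h1
  have h2 : ({f : Fin K → Fin n | ¬ ∀ i ∈ I, ∃ k, f k ∈ S i} : Finset _) ⊆
      I.biUnion fun i => {f : Fin K → Fin n | ∀ k, f k ∉ S i} := by
    intro f hf
    simp only [mem_filter, mem_univ, true_and, not_forall, not_exists] at hf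
    obtain ⟨i, hi, hf⟩ := hf
    simp only [mem_biUnion, mem_filter, mem_univ, true_and]
    exact ⟨i, hi, hf⟩
  have h3 : #{f : Fin K → Fin n | ¬ ∀ i ∈ I, ∃ k, f k ∈ S i} ≤ n ^ 2 * (n - h) ^ K := by
    refine ((card_le_card h2).trans card_biUnion_le).trans ?_
    calc _ = ∑ i ∈ I, (n - h) ^ K := sum_congr rfl fun i hi => by
            rw [card_avoiding, hS i hi, Fintype.card_fin]
      _ ≤ _ := by rw [sum_const, smul_eq_mul]; gcongr
  have h4 : ((#{f : Fin K → Fin n | ∀ i ∈ I, ∃ k, f k ∈ S i} : ℕ) : ℝ) +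
      #{f : Fin K → Fin n | ¬ ∀ i ∈ I, ∃ k, f k ∈ S i} = (n : ℝ) ^ K := by exact_mod_cast h1
  have h5 : ((#{f : Fin K → Fin n | ¬ ∀ i ∈ I, ∃ k, f k ∈ S i} : ℕ) : ℝ) ≤
      n ^ 2 * ((n - h : ℕ) : ℝ) ^ K := by exact_mod_cast h3
  have h6 := avoiding_ratio_le hn hK
  have h7 : (n : ℝ) ^ 2 * ((n : ℝ) ^ K * (n : ℝ) ^ (-(α + 1))) =
      (n : ℝ) ^ K * (1 / (n : ℝ) ^ (α - 1)) := by
    rw [one_div, ← Real.rpow_neg hn0.le, ← Real.rpow_natCast (n : ℝ) 2, mul_left_comm,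
      ← Real.rpow_add hn0]
    congr 2
    push_cast; ring
  calc _ ≤ (n : ℝ) ^ 2 * ((n - h : ℕ) : ℝ) ^ K := by linarith
    _ ≤ (n : ℝ) ^ 2 * ((n : ℝ) ^ K * (n : ℝ) ^ (-(α + 1))) := by gcongr
    _ = _ := h7

lemma le_toOuterMeasure_uniform {Ω : Type} [Fintype Ω] [Nonempty Ω] [DecidableEq Ω]
    (S : Finset Ω) (T : Set Ω) (hST : ∀ a ∈ S, a ∈ T) {δ : ℝ}
    (h : (Fintype.card Ω : ℝ) - #S ≤ Fintype.card Ω * δ) :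
    ENNReal.ofReal (1 - δ) ≤ (PMF.uniformOfFintype Ω).toOuterMeasure T := by
  have hpos : (0 : ℝ) < Fintype.card Ω := by exact_mod_cast Fintype.card_pos
  calc ENNReal.ofReal (1 - δ) ≤ ENNReal.ofReal (#S / Fintype.card Ω) := by
        apply ENNReal.ofReal_le_ofReal
        rw [le_div_iff₀ hpos]; linarith
    _ = #S / Fintype.card Ω := by
        rw [ENNReal.ofReal_div_of_pos hpos, ENNReal.ofReal_natCast, ENNReal.ofReal_natCast]
    _ = (PMF.uniformOfFintype Ω).toOuterMeasure (S : Set Ω) := by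
        rw [PMF.toOuterMeasure_uniformOfFintype_apply]
        simp
    _ ≤ _ := (PMF.uniformOfFintype Ω).toOuterMeasure.mono hST

/-- For a sample of `K` centres, with high probability, every reachable vertex has a shortest path
on which among any `h` consecutive vertices there is a centre. -/
lemma exists_good_samples {n h K : ℕ} {α : ℝ} (hn : 2 ≤ n) (hh : 1 ≤ h)
    (hK : (α + 1) * n * Real.log n ≤ h * K) (G : SimpleGraph (Fin n)) (w : Sym2 (Fin n) → ℕ)
    (s : Fin n) :
    ∃ S : Finset (Fin K → Fin n),
      (n : ℝ) ^ K - #S ≤ (n : ℝ) ^ K * (1 / (n : ℝ) ^ (α - 1)) ∧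
      ∀ f ∈ S, ∀ v, G.Reachable s v → ∃ P : G.Walk s v, P.IsPath ∧
        (∀ Q : G.Walk s v, Q.IsPath → walkLength w P ≤ walkLength w Q) ∧
        HitsChain f h P.getVert P.length := by
  classical
  -- The paths are fixed independently of the sample, so a union bound over the windows `(v, i)`
  -- applies.
  choose! P hP hmin using fun (v : Fin n) (hv : G.Reachable s v) => exists_shortest_path hv w
  let I : Finset (Fin n × Fin n) :=
    {i | ∃ hv : G.Reachable s i.1, i.2.val + h ≤ (P i.1 hv).length}
  let S : Fin n × Fin n → Finset (Fin n) := fun i =>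
    if hv : G.Reachable s i.1 then (Finset.Ico i.2.val (i.2.val + h)).image (P i.1 hv).getVert
    else ∅
  refine ⟨_, sample_hits_all hn hK I ?_ S ?_, ?_⟩
  · refine (card_le_univ _).trans ?_
    simp [sq]
  · rintro ⟨v, i⟩ hi
    obtain ⟨hv, hle⟩ := (mem_filter.mp hi).2
    simp only [S, dif_pos hv]
    rw [card_image_of_injOn, Nat.card_Ico, Nat.add_sub_cancel_left]
    -- A path repeats no vertex, so a window has exactly `h` elements.
    refine (hP v hv).getVert_injOn.mono fun t ht => ?_
    simp only [coe_Ico, Set.mem_Ico] at ht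
    simp only [Set.mem_ofPred_eq] at hle ⊢
    omega
  · intro f hf v hv
    refine ⟨P v hv, hP v hv, hmin v hv, fun i hi => ?_⟩
    have hlen := (hP v hv).length_lt
    rw [Fintype.card_fin] at hlen
    have hI : (v, (⟨i, by omega⟩ : Fin n)) ∈ I := mem_filter.mpr ⟨mem_univ _, hv, hi⟩
    simp only [mem_filter, mem_univ, true_and] at hf
    obtain ⟨k, hk⟩ := hf _ hI
    simp only [S, dif_pos hv, mem_image, Finset.mem_Ico] at hk
    obtain ⟨t, ⟨h1, h2⟩, h3⟩ := hk
    exact ⟨k, t, h1, h2, h3.symm⟩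

end Sampling

/-! ### Minima and bounded collections computed in one reading of the stream. -/

section Folds

lemma foldl_optMin_eq_some {γ ρ : Type} {φ : γ → ℕ} {f : ρ → Option γ} {rs : List ρ}
    {b : Option γ} {g : γ} (h : rs.foldl (fun b r => optMin φ b (f r)) b = some g) :
    b = some g ∨ ∃ r ∈ rs, f r = some g := by
  induction rs generalizing b with
  | nil => exact Or.inl h
  | cons r rs ih =>
    rcases ih h with h | ⟨r', hr', h⟩
    · rcases optMin_eq_some h with h | h
      · exact Or.inl h
      · exact Or.inr ⟨r, by simp, h⟩
    · exact Or.inr ⟨r', by simp [hr'], h⟩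

lemma foldl_optMin_le_init {γ ρ : Type} {φ : γ → ℕ} {f : ρ → Option γ} (rs : List ρ) (g : γ) :
    ∃ g', rs.foldl (fun b r => optMin φ b (f r)) (some g) = some g' ∧ φ g' ≤ φ g := by
  induction rs generalizing g with
  | nil => exact ⟨g, rfl, le_rfl⟩
  | cons r rs ih =>
    obtain ⟨j, hj, hle⟩ := optMin_le_left (φ := φ) (b := f r) g
    obtain ⟨g', hg', hle'⟩ := ih j
    exact ⟨g', by rw [List.foldl_cons, hj, hg'], hle'.trans hle⟩

lemma foldl_optMin_le {γ ρ : Type} {φ : γ → ℕ} {f : ρ → Option γ} {rs : List ρ} {r : ρ}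
    (hr : r ∈ rs) {g : γ} (hg : f r = some g) (b : Option γ) :
    ∃ g', rs.foldl (fun b r => optMin φ b (f r)) b = some g' ∧ φ g' ≤ φ g := by
  induction rs generalizing b with
  | nil => simp at hr
  | cons r' rs ih =>
    rcases List.mem_cons.mp hr with rfl | hr
    · obtain ⟨j, hj, hle⟩ := optMin_le_right (φ := φ) (a := b) g
      obtain ⟨g', hg', hle'⟩ := foldl_optMin_le_init (φ := φ) (f := f) rs j
      exact ⟨g', by rw [List.foldl_cons, hg, hj, hg'], hle'.trans hle⟩
    · exact ih hr _

variable {κ ι ρ : Type} [Fintype κ] [DecidableEq κ]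

/-- The number of points at which a partial function is defined. -/
def supportCard (f : κ → Option ι) : ℕ := (Finset.univ.filter fun k => (f k).isSome).card

omit [DecidableEq κ] in
lemma supportCard_none : supportCard (fun _ : κ => (none : Option ι)) = 0 := by
  simp [supportCard]

lemma supportCard_update {f : κ → Option ι} {k : κ} (hk : f k = none) (i : ι) :
    supportCard (Function.update f k (some i)) = supportCard f + 1 := by
  have : (Finset.univ.filter fun k' => (Function.update f k (some i) k').isSome) =
      insert k (Finset.univ.filter fun k' => (f k').isSome) := by
    ext k'
    by_cases h : k' = k
    · subst h; simp
    · simp [h]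
  rw [supportCard, this, Finset.card_insert_of_notMem (by simp [hk])]
  rfl

omit [DecidableEq κ] in
lemma supportCard_le (f : κ → Option ι) : supportCard f ≤ Fintype.card κ :=
  Finset.card_le_univ _

lemma supportCard_or {f g : κ → Option ι} (h : ∀ k i, f k = some i → g k = none) :
    supportCard (fun k => (f k).or (g k)) = supportCard f + supportCard g := by
  rw [supportCard, supportCard, supportCard, ← Finset.card_union_of_disjoint]
  · congr 1
    ext k
    simp only [Finset.mem_filter, Finset.mem_univ, true_and, Finset.mem_union]
    rcases f k with _ | i <;> simp
  · rw [Finset.disjoint_filter]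
    intro k _ hf
    obtain ⟨i, hi⟩ := Option.isSome_iff_exists.mp hf
    simp [h k i hi]

open Classical in
/-- Add the value `i` at the point `k` if `q` holds, unless the point is taken or `M` points
are. -/
noncomputable def addUpTo (M : ℕ) (q : Prop) (k : κ) (i : ι) (f : κ → Option ι) :
    κ → Option ι :=
  if q ∧ f k = none ∧ supportCard f < M then Function.update f k (some i) else f

lemma supportCard_addUpTo_le {M : ℕ} {q : Prop} {k : κ} {i : ι} {f : κ → Option ι}
    (h : supportCard f ≤ M) : supportCard (addUpTo M q k i f) ≤ M := by
  unfold addUpTo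
  split_ifs with h1
  · rw [supportCard_update h1.2.1]; omega
  · exact h

lemma addUpTo_eq_some {M : ℕ} {q : Prop} {k k' : κ} {i i' : ι} {f : κ → Option ι}
    (h : addUpTo M q k i f k' = some i') : f k' = some i' ∨ q ∧ k = k' ∧ i = i' := by
  unfold addUpTo at h
  split_ifs at h with h1
  · by_cases hk : k' = k
    · subst hk
      rw [Function.update_self] at h
      exact Or.inr ⟨h1.1, rfl, Option.some.inj h⟩
    · rw [Function.update_of_ne hk] at h
      exact Or.inl h
  · exact Or.inl h

variable {M : ℕ} {q : ρ → Prop} {key : ρ → κ} {val : ρ → ι}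

lemma foldl_addUpTo_card (rs : List ρ) {f : κ → Option ι} (hf : supportCard f ≤ M) :
    supportCard (rs.foldl (fun f r => addUpTo M (q r) (key r) (val r) f) f) ≤ M := by
  induction rs generalizing f with
  | nil => exact hf
  | cons r rs ih => exact ih (supportCard_addUpTo_le hf)

lemma foldl_addUpTo_eq_some (rs : List ρ) {k : κ} {i : ι} {f : κ → Option ι}
    (h : rs.foldl (fun f r => addUpTo M (q r) (key r) (val r) f) f k = some i) :
    f k = some i ∨ ∃ r ∈ rs, q r ∧ key r = k ∧ val r = i := by
  induction rs generalizing f with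
  | nil => exact Or.inl h
  | cons r rs ih =>
    rcases ih h with h | ⟨r', hr', h⟩
    · rcases addUpTo_eq_some h with h | h
      · exact Or.inl h
      · exact Or.inr ⟨r, by simp, h⟩
    · exact Or.inr ⟨r', by simp [hr'], h⟩

/-- The number of taken points never decreases during the fold. If it ends below `M`, it was below
`M` throughout and nothing was refused for lack of room; this certifies that a level is complete. -/
lemma foldl_addUpTo_ne_none (rs : List ρ)
    (h : supportCard (rs.foldl (fun f r => addUpTo M (q r) (key r) (val r) f)
      (fun _ => none)) < M) {r : ρ} (hr : r ∈ rs) (hq : q r) :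
    rs.foldl (fun f r => addUpTo M (q r) (key r) (val r) f) (fun _ => none) (key r) ≠ none := by
  induction rs using List.reverseRecOn with
  | nil => simp at hr
  | append_singleton rs r' ih =>
    rw [List.foldl_append, List.foldl_cons, List.foldl_nil] at h ⊢
    set f := rs.foldl (fun f r => addUpTo M (q r) (key r) (val r) f) (fun _ => none) with hf
    have hM : supportCard f < M := by
      unfold addUpTo at h
      split_ifs at h with h1
      · exact h1.2.2
      · exact h
    unfold addUpTo
    rcases List.mem_append.mp hr with hr | hr
    · have := ih hM hr
      split_ifs with h1
      · by_cases hk : key r = key r'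
        · rw [hk, Function.update_self]; simp
        · rwa [Function.update_of_ne hk]
      · exact this
    · obtain rfl := List.mem_singleton.mp hr
      split_ifs with h1
      · rw [Function.update_self]; simp
      · intro hn
        exact h1 ⟨hq, hn, hM⟩

end Folds

/-! ### Chains of segments between centres. -/

section Matrix

variable {V X : Type}

/-- `d` is the length of a chain of segments between centres that leads from `s` to the
centre, where `mat (y, x)` bounds the distance from `x` to `y`. -/
inductive MatrixValue (ctr : X → V) (s : V) (mat : X × X → Option ℕ) : X → ℕ → Prop
  | source {x : X} (h : ctr x = s) : MatrixValue ctr s mat x 0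
  | step {x y : X} {d e : ℕ} (h : MatrixValue ctr s mat x d) (he : mat (y, x) = some e) :
      MatrixValue ctr s mat y (d + e)

/-- All intermediate points of a chain are centres, so the small matrix in the memory determines the
chain values of centres. -/
lemma matrixValue_iff {ctr : X → V} {s : V} {mat : X × X → Option ℕ}
    {b : V × X → Option (ℕ × V)} (h : ∀ y x, mat (y, x) = (b (ctr y, x)).map Prod.fst)
    {x : X} {d : ℕ} : MatrixValue ctr s mat x d ↔ ChainValue ctr s b (ctr x) d := by
  constructor
  · intro hd
    induction hd with
    | source h => exact h ▸ .source
    | step _ he ih =>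
      rw [h, Option.map_eq_some_iff] at he
      obtain ⟨i, hi, rfl⟩ := he
      exact .step ih hi
  · generalize hv : ctr x = v
    intro hd
    induction hd generalizing x with
    | source => exact .source hv
    | step _ hb ih => exact .step (ih rfl) (by rw [h, hv, hb]; rfl)

open Classical in
/-- The least natural number with the property `p`, if any. -/
noncomputable def leastValue (p : ℕ → Prop) : Option ℕ :=
  if h : ∃ d, p d then some (Nat.find h) else none

lemma leastValue_eq_some {p : ℕ → Prop} {d : ℕ} (h : leastValue p = some d) :
    p d ∧ ∀ d', p d' → d ≤ d' := by
  classical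
  unfold leastValue at h
  split_ifs at h with h1
  obtain rfl := Option.some.inj h
  exact ⟨Nat.find_spec h1, fun d' => Nat.find_min' h1⟩

lemma exists_leastValue {p : ℕ → Prop} {d : ℕ} (h : p d) :
    ∃ d', leastValue p = some d' ∧ d' ≤ d := by
  classical
  exact ⟨_, dif_pos ⟨d, h⟩, Nat.find_min' _ h⟩

end Matrix

/-! ### The streaming program and the effect of a single pass. -/

section Program

/-- What a cell stores for a vertex and a centre: level and predecessor in the current search, and
the best bound and predecessor that the searches so far have found. -/
abbrev PairData (n : ℕ) : Type := Option (ℕ × Fin n) × Option (ℕ × Fin n)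

/-- The records of the streams. The cell of an oriented edge and a centre holds the data of
both end points. -/
inductive SearchRec (n K : ℕ) : Type
  | edge (u v : Fin n) (w : ℕ)
  | cell (u v : Fin n) (w : ℕ) (x : Fin (K + 1)) (du dv : PairData n)
  | pred (v p : Fin n)

/-- The control part of the memory. Stage `0` reads the input, stage `1` searches, and stage `2`
writes the predecessors. -/
structure SearchCtl (n K : ℕ) : Type where
  ctr : Fin (K + 1) → Fin n
  stage : Fin 3
  tot : ℕ
  scale : ℕ
  round : ℕ
  lev : ℕ
  chunk : ℕ
  pend : Fin n × Fin (K + 1) → Option (ℕ × Fin n)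
  mat : Fin (K + 1) × Fin (K + 1) → Option ℕ

/-- The part of the memory that is filled in during a pass. -/
structure SearchAcc (n K M : ℕ) : Type where
  tot : ℕ
  pend : Fin n × Fin (K + 1) → Option (ℕ × Fin n)
  mat : Fin (K + 1) × Fin (K + 1) → Option ℕ
  sel : Fin M → Option (Fin (K + 1) × ℕ × Fin n)

/-- The parameters: `K` sampled centres, at most `M` pairs handled in a pass, hop bound `h`,
precision `E`, and the bound `cap` for the total weight. -/
structure SearchParams : Type where
  n : ℕ
  K : ℕ
  M : ℕ
  h : ℕ
  E : ℕ
  cap : ℕ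
  M_pos : 0 < M

namespace SearchParams

variable (P : SearchParams)

abbrev Vtx : Type := Fin P.n
abbrev Ctr : Type := Fin (P.K + 1)
abbrev Cell : Type := P.Vtx × P.Vtx × ℕ × P.Ctr

/-- The largest rounded length that a search has to reach. -/
def radius : ℕ := P.h * P.E + P.h

/-- The number of collecting rounds at each scale. -/
def rounds : ℕ := P.radius + P.n * (P.K + 1) / P.M + 1

/-- The number of chunks of `M` vertices. -/
def chunks : ℕ := P.n / P.M + 1

/-- The number of scales for total weight `W`. -/
def scales (W : ℕ) : ℕ := Nat.clog 2 W + 2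

/-- The value of a unit of weight. -/
def base : ℕ := P.n + 1

variable {P}

/-- The new data of a pair: in a collecting round the pending entries are committed, and
after the last round of a scale the search result is merged into the best bounds. -/
def update (a : SearchCtl P.n P.K) (k : P.Vtx × P.Ctr) (d : PairData P.n) : PairData P.n :=
  if a.round < P.rounds then ((a.pend k).or d.1, d.2)
  else (none, improve (scaleUnit P.base a.scale) d.2 ((a.pend k).or d.1))

/-- Whether a cell shows that its second end point can be given the current level. -/
def CellEligible (a : SearchCtl P.n P.K) (u v : P.Vtx) (w : ℕ) (x : P.Ctr)
    (cu cv : Option (ℕ × P.Vtx)) : Prop :=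
  v ≠ a.ctr x ∧ cv = none ∧ ∃ l, (if u = a.ctr x then some 0 else cu.map Prod.fst) = some l ∧
    l + scaleWeight P.base P.h P.E a.scale w ≤ a.lev

/-- The length of a shortest chain of segments from the source to a centre. -/
noncomputable def centreDist (a : SearchCtl P.n P.K) (x : P.Ctr) : Option ℕ :=
  leastValue (MatrixValue a.ctr (a.ctr 0) a.mat x)

/-- The chain that a pair of vertex and centre offers for the vertex. -/
noncomputable def candidate (a : SearchCtl P.n P.K) (x : P.Ctr) (b : Option (ℕ × P.Vtx)) :
    Option (P.Ctr × ℕ × P.Vtx) :=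
  (centreDist a x).bind fun _ => b.map fun i => (x, i.1, i.2)

/-- The length of a chain. -/
noncomputable def candidateLength (a : SearchCtl P.n P.K) (g : P.Ctr × ℕ × P.Vtx) : ℕ :=
  (centreDist a g.1).getD 0 + g.2.1

/-- During the search the tests use the updated data, so pending entries already count before they
are written back. The field `sel` reads `dv.2` as stored, since the output stage changes no cell.
Every field is computed in every pass; `closePass` picks those that matter. -/
noncomputable def readRec (a : SearchCtl P.n P.K) (b : SearchAcc P.n P.K P.M) :
    SearchRec P.n P.K → SearchAcc P.n P.K P.M
  | .edge _ _ w => { b with tot := min P.cap (b.tot + w) }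
  | .cell u v w x du dv =>
    { tot := b.tot
      pend := addUpTo P.M
        (CellEligible a u v w x (update a (u, x) du).1 (update a (v, x) dv).1) (v, x)
        (a.lev, u) b.pend
      mat := fun k => optMin id (b.mat k)
        (if v = a.ctr k.1 ∧ x = k.2 then (update a (v, x) dv).2.map Prod.fst else none)
      sel := fun i => optMin (candidateLength a) (b.sel i)
        (if v ≠ a.ctr 0 ∧ v.val / P.M = a.chunk ∧ v.val % P.M = i.val then candidate a x dv.2
          else none) }
  | .pred _ _ => b

/-- The new data of a pair depends only on the control and its old data, so its copies in different
cells stay equal. The last output pass drops the cells, and only predecessors remain. -/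
def writeRec (a : SearchCtl P.n P.K) (r : SearchRec P.n P.K) : List (SearchRec P.n P.K) :=
  if a.stage = 0 then
    match r with
    | .edge u v w => (List.finRange (P.K + 1)).flatMap fun x =>
        [.cell u v w x (none, none) (none, none), .cell v u w x (none, none) (none, none)]
    | _ => []
  else if a.stage = 1 then
    match r with
    | .cell u v w x du dv => [.cell u v w x (update a (u, x) du) (update a (v, x) dv)]
    | _ => []
  else
    match r with
    | .edge _ _ _ => []
    | .cell u v w x du dv => if a.chunk + 1 < P.chunks then [.cell u v w x du dv] else []
    | .pred v p => [.pred v p]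

/-- The level rises only if fewer than `M` pairs were collected. The pass that merges the last scale
also supplies `mat`. -/
def closePass (a : SearchCtl P.n P.K) (b : SearchAcc P.n P.K P.M) :
    SearchCtl P.n P.K × List (SearchRec P.n P.K) :=
  if a.stage = 0 then ({ a with stage := 1, tot := b.tot }, [])
  else if a.stage = 1 then
    if a.round < P.rounds then
      ({ a with
          round := a.round + 1
          lev := if supportCard b.pend < P.M then a.lev + 1 else a.lev
          pend := b.pend }, [])
    else if a.scale + 1 < scales a.tot then
      ({ a with scale := a.scale + 1, round := 0, lev := 1, pend := fun _ => none }, [])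
    else ({ a with stage := 2, pend := fun _ => none, mat := b.mat }, [])
  else
    ({ a with chunk := min P.chunks (a.chunk + 1) },
      (List.finRange P.n).filterMap fun v =>
        if v.val / P.M = a.chunk then
          (b.sel ⟨v.val % P.M, Nat.mod_lt _ P.M_pos⟩).map fun g => .pred v g.2.2
        else none)

variable (P) in
/-- The streaming program for approximate shortest paths. -/
noncomputable def program : StreamProgram (SearchCtl P.n P.K) (SearchAcc P.n P.K P.M)
    (SearchRec P.n P.K) (P.Vtx × P.Vtx × ℕ) (P.Vtx × P.Vtx) where
  -- The truncation keeps the set of records finite for arbitrary input; it changes nothing when the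
  -- total weight is at most `cap`.
  encode r := .edge r.1 r.2.1 (min P.cap r.2.2)
  decode
    | .edge u v _ => (u, v)
    | .cell u v _ _ _ _ => (u, v)
    | .pred v p => (v, p)
  init := ⟨0, fun _ => none, fun _ => none, fun _ => none⟩
  read := readRec
  write := writeRec
  close := closePass
  halted a := decide (a.stage = 2 ∧ P.chunks ≤ a.chunk)

variable (P) in
/-- The control before the first pass. -/
def initCtl (ctr : P.Ctr → P.Vtx) : SearchCtl P.n P.K where
  ctr := ctr
  stage := 0
  tot := 0
  scale := 0
  round := 0
  lev := 1
  chunk := 0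
  pend _ := none
  mat _ := none

variable (P) in
/-- The cells of an edge list. -/
def cells (L : List (P.Vtx × P.Vtx × ℕ)) : List P.Cell :=
  L.flatMap fun r => (List.finRange (P.K + 1)).flatMap fun x =>
    [(r.1, r.2.1, r.2.2, x), (r.2.1, r.1, r.2.2, x)]

lemma mem_cells {L : List (P.Vtx × P.Vtx × ℕ)} {u v : P.Vtx} {w : ℕ} {x : P.Ctr} :
    (u, v, w, x) ∈ P.cells L ↔ (u, v, w) ∈ L ∨ (v, u, w) ∈ L := by
  simp only [cells, List.mem_flatMap, List.mem_finRange, true_and, List.mem_cons,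
    List.not_mem_nil, or_false, Prod.mk.injEq]
  constructor
  · rintro ⟨⟨a, b, c⟩, h, y, ⟨rfl, rfl, rfl, rfl⟩ | ⟨rfl, rfl, rfl, rfl⟩⟩
    · exact Or.inl h
    · exact Or.inr h
  · rintro (h | h)
    · exact ⟨_, h, x, Or.inl ⟨rfl, rfl, rfl, rfl⟩⟩
    · exact ⟨_, h, x, Or.inr ⟨rfl, rfl, rfl, rfl⟩⟩

lemma length_cells (L : List (P.Vtx × P.Vtx × ℕ)) :
    (P.cells L).length = L.length * ((P.K + 1) * 2) := by
  simp [cells, List.length_flatMap]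

/-- The record of a cell when the data of the pairs is given by `T`. -/
def cellRec (T : P.Vtx × P.Ctr → PairData P.n) (c : P.Cell) : SearchRec P.n P.K :=
  .cell c.1 c.2.1 c.2.2.1 c.2.2.2 (T (c.1, c.2.2.2)) (T (c.2.1, c.2.2.2))

section Pass

variable (a : SearchCtl P.n P.K) (T : P.Vtx × P.Ctr → PairData P.n) (Cs : List P.Cell)
  (ps : List (P.Vtx × P.Vtx))

/-- The content of the accumulator at the end of a pass over cells and predecessors. -/
noncomputable def endAcc : SearchAcc P.n P.K P.M :=
  List.foldl (readRec a) P.program.init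
    (Cs.map (cellRec T) ++ ps.map fun r => SearchRec.pred r.1 r.2)

lemma endAcc_eq : endAcc a T Cs ps = (Cs.map (cellRec T)).foldl (readRec a) P.program.init := by
  rw [endAcc, List.foldl_append]
  generalize List.foldl (readRec a) P.program.init (Cs.map (cellRec T)) = b
  induction ps with
  | nil => rfl
  | cons r ps ih => exact ih

/-- Each field of the accumulator evolves independently of the others, so the projection commutes
with the fold. -/
lemma pend_endAcc : (endAcc a T Cs ps).pend = Cs.foldl (fun f c => addUpTo P.M
    (CellEligible a c.1 c.2.1 c.2.2.1 c.2.2.2 (update a (c.1, c.2.2.2) (T (c.1, c.2.2.2))).1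
      (update a (c.2.1, c.2.2.2) (T (c.2.1, c.2.2.2))).1) (c.2.1, c.2.2.2)
        (a.lev, c.1) f) fun _ => none := by
  rw [endAcc_eq, List.foldl_map]
  exact (List.foldl_hom SearchAcc.pend fun _ _ => rfl).symm

lemma mat_endAcc (k : P.Ctr × P.Ctr) : (endAcc a T Cs ps).mat k =
    Cs.foldl (fun b c => optMin id b (if c.2.1 = a.ctr k.1 ∧ c.2.2.2 = k.2 then
      (update a (c.2.1, c.2.2.2) (T (c.2.1, c.2.2.2))).2.map Prod.fst else none)) none := by
  rw [endAcc_eq, List.foldl_map]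
  exact (List.foldl_hom (fun b : SearchAcc P.n P.K P.M => b.mat k) fun _ _ => rfl).symm

lemma sel_endAcc (i : Fin P.M) : (endAcc a T Cs ps).sel i =
    Cs.foldl (fun b c => optMin (candidateLength a) b
      (if c.2.1 ≠ a.ctr 0 ∧ c.2.1.val / P.M = a.chunk ∧ c.2.1.val % P.M = i.val then
        candidate a c.2.2.2 (T (c.2.1, c.2.2.2)).2 else none)) none := by
  rw [endAcc_eq, List.foldl_map]
  exact (List.foldl_hom (fun b : SearchAcc P.n P.K P.M => b.sel i) fun _ _ => rfl).symm

end Pass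

/-- The predecessor that is chosen for a vertex. -/
noncomputable def chosenPred (a : SearchCtl P.n P.K) (T : P.Vtx × P.Ctr → PairData P.n)
    (Cs : List P.Cell) (v : P.Vtx) : Option P.Vtx :=
  (Cs.foldl (fun b c => optMin (candidateLength a) b
    (if v ≠ a.ctr 0 ∧ c.2.1 = v then candidate a c.2.2.2 (T (c.2.1, c.2.2.2)).2 else none))
    none).map fun g => g.2.2

/-- The pairs that are written for a chunk of vertices. -/
def chunkOutput (M : ℕ) {n : ℕ} (pr : Fin n → Option (Fin n)) (j : ℕ) : List (Fin n × Fin n) :=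
  (List.finRange n).filterMap fun v => if v.val / M = j then (pr v).map fun p => (v, p) else none

lemma next_stage_two {a : SearchCtl P.n P.K} (ha : a.stage = 2)
    (T : P.Vtx × P.Ctr → PairData P.n) (Cs : List P.Cell) (ps : List (P.Vtx × P.Vtx)) :
    P.program.next (a, Cs.map (cellRec T) ++ ps.map fun r => SearchRec.pred r.1 r.2) =
      ({ a with chunk := min P.chunks (a.chunk + 1) },
        (if a.chunk + 1 < P.chunks then Cs.map (cellRec T) else []) ++
          (ps ++ chunkOutput P.M (chosenPred a T Cs) a.chunk).map fun r => SearchRec.pred r.1 r.2) := by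
  have h0 : ¬ a.stage = 0 := by rw [ha]; decide
  have h1 : ¬ a.stage = 1 := by rw [ha]; decide
  have hc : ∀ b, P.program.close a b = closePass a b := fun _ => rfl
  have hw : P.program.write a = writeRec a := rfl
  have hr : List.foldl (P.program.read a) P.program.init
      (Cs.map (cellRec T) ++ ps.map fun r => SearchRec.pred r.1 r.2) = endAcc a T Cs ps := rfl
  unfold StreamProgram.next
  dsimp only
  rw [hr, hc, hw, closePass, if_neg h0, if_neg h1]
  refine Prod.ext rfl ?_
  dsimp only
  rw [List.flatMap_append, List.map_append, List.append_assoc]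
  congr 1
  · split_ifs with h
    · rw [List.flatMap_map, List.map_eq_flatMap]
      simp [writeRec, h0, h1, cellRec, h]
    · rw [List.flatMap_map]
      simp [writeRec, h0, h1, cellRec, h]
  congr 1
  · rw [List.flatMap_map, List.map_eq_flatMap]
    simp [writeRec, h0, h1]
  · rw [chunkOutput, List.map_filterMap]
    congr 1
    funext v
    split_ifs with h
    · rw [sel_endAcc, chosenPred, Option.map_map, Option.map_map]
      -- Quotient and remainder modulo `M` determine the vertex, so a slot of `sel` serves one
      -- vertex per chunk.
      have : ∀ c : P.Cell, (c.2.1 ≠ a.ctr 0 ∧ c.2.1.val / P.M = a.chunk ∧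
          c.2.1.val % P.M = v.val % P.M) ↔ (v ≠ a.ctr 0 ∧ c.2.1 = v) := by
        intro c
        constructor
        · rintro ⟨h1, h2, h3⟩
          have : c.2.1 = v := by
            apply Fin.ext
            rw [← Nat.div_add_mod c.2.1.val P.M, ← Nat.div_add_mod v.val P.M, h2, h3, h]
          exact ⟨this ▸ h1, this⟩
        · rintro ⟨h1, h2⟩
          exact ⟨h2 ▸ h1, by rw [h2]; exact h, by rw [h2]⟩
      simp only [this]
      rfl
    · rfl

lemma next_stage_one {a : SearchCtl P.n P.K} (ha : a.stage = 1)
    (T : P.Vtx × P.Ctr → PairData P.n) (Cs : List P.Cell) :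
    P.program.next (a, Cs.map (cellRec T)) =
      ((closePass a (endAcc a T Cs [])).1, Cs.map (cellRec fun k => update a k (T k))) := by
  have h0 : ¬ a.stage = 0 := by rw [ha]; decide
  have hc : ∀ b, P.program.close a b = closePass a b := fun _ => rfl
  have hw : P.program.write a = writeRec a := rfl
  have hr : List.foldl (P.program.read a) P.program.init
      (Cs.map (cellRec T)) = endAcc a T Cs [] := (endAcc_eq a T Cs []).symm
  unfold StreamProgram.next
  dsimp only
  rw [hr, hc, hw]
  refine Prod.ext rfl ?_
  have hnil : (closePass a (endAcc a T Cs [])).2 = [] := by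
    rw [closePass, if_neg h0, if_pos ha]
    split_ifs <;> rfl
  dsimp only
  rw [hnil, List.append_nil, List.flatMap_map]
  simp [writeRec, ha, cellRec, ← List.map_eq_flatMap]

lemma tot_foldl (a : SearchCtl P.n P.K) (L : List (P.Vtx × P.Vtx × ℕ))
    (b : SearchAcc P.n P.K P.M) :
    ((L.map P.program.encode).foldl (readRec a) b).tot =
      if L = [] then b.tot else min P.cap (b.tot + (L.map fun r => min P.cap r.2.2).sum) := by
  induction L generalizing b with
  | nil => rfl
  | cons r L ih =>
    rw [List.map_cons, List.foldl_cons, ih]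
    have : (readRec a b (P.program.encode r)).tot = min P.cap (b.tot + min P.cap r.2.2) := rfl
    rw [this]
    simp only [reduceCtorEq, if_false, List.map_cons, List.sum_cons]
    split_ifs with h
    · simp [h]
    · omega

lemma next_initCtl (ctr : P.Ctr → P.Vtx) (L : List (P.Vtx × P.Vtx × ℕ))
    (hL : (L.map fun r => r.2.2).sum ≤ P.cap) :
    P.program.next (P.initCtl ctr, L.map P.program.encode) =
      ({ P.initCtl ctr with stage := 1, tot := (L.map fun r => r.2.2).sum },
        (P.cells L).map (cellRec fun _ => (none, none))) := by
  have hmin : ∀ r ∈ L, min P.cap r.2.2 = r.2.2 := fun r hr =>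
    min_eq_right ((List.single_le_sum (by simp) _ (List.mem_map_of_mem hr)).trans hL)
  have hc : ∀ b, P.program.close (P.initCtl ctr) b =
      ({ P.initCtl ctr with stage := 1, tot := b.tot }, []) := fun _ => rfl
  have htot : ((L.map P.program.encode).foldl (P.program.read (P.initCtl ctr))
      P.program.init).tot = (L.map fun r => r.2.2).sum := by
    refine (tot_foldl (P.initCtl ctr) L P.program.init).trans ?_
    rw [List.map_congr_left hmin]
    change (if L = [] then 0 else min P.cap (0 + _)) = _
    split_ifs with h
    · simp [h]
    · rw [zero_add, min_eq_right hL]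
  unfold StreamProgram.next
  dsimp only
  rw [hc]
  refine Prod.ext ?_ ?_
  · dsimp only; rw [htot]
  · dsimp only
    rw [List.append_nil, List.flatMap_map, cells, List.map_flatMap]
    refine List.flatMap_congr fun r hr => ?_
    rw [List.map_flatMap]
    change (List.finRange (P.K + 1)).flatMap _ = _
    refine List.flatMap_congr fun x _ => ?_
    simp [cellRec, hmin r hr]

end SearchParams

end Program

/-! ### Invariants of the search and of the output stage. -/

section Correctness

lemma isEdgeList_mem_iff {V : Type} {G : SimpleGraph V} {w : Sym2 V → ℕ}
    {L : List (V × V × ℕ)} (hL : IsEdgeList G w L) {u v : V} {k : ℕ} :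
    (u, v, k) ∈ L ∨ (v, u, k) ∈ L ↔ G.Adj u v ∧ k = w s(u, v) := by
  obtain ⟨-, h2, h3⟩ := hL
  constructor
  · rintro (h | h)
    · exact ⟨(h2 s(u, v)).mpr (List.mem_map_of_mem (f := fun r => s(r.1, r.2.1)) h), h3 _ h⟩
    · refine ⟨((h2 s(v, u)).mpr (List.mem_map_of_mem (f := fun r => s(r.1, r.2.1)) h)).symm, ?_⟩
      rw [Sym2.eq_swap]
      exact h3 _ h
  · rintro ⟨hadj, rfl⟩
    obtain ⟨⟨a, b, k⟩, hr, he⟩ := List.mem_map.mp ((h2 s(u, v)).mp hadj)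
    have hk := h3 _ hr
    simp only at hk he
    rw [he] at hk
    subst hk
    rcases Sym2.eq_iff.mp he with ⟨rfl, rfl⟩ | ⟨rfl, rfl⟩
    · exact Or.inl hr
    · exact Or.inr hr

lemma isEdgeList_sum {V : Type} [Fintype V] {G : SimpleGraph V} {w : Sym2 V → ℕ}
    {L : List (V × V × ℕ)} (hL : IsEdgeList G w L) :
    (L.map fun r => r.2.2).sum = totalWeight G w := by
  classical
  obtain ⟨h1, h2, h3⟩ := hL
  have : (L.map fun r => r.2.2) = (L.map fun r => s(r.1, r.2.1)).map w := by
    rw [List.map_map]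
    exact List.map_congr_left h3
  rw [this, ← List.sum_toFinset _ h1, totalWeight]
  refine Finset.sum_congr ?_ fun _ _ => rfl
  ext e
  rw [List.mem_toFinset, ← h2]
  simp

namespace SearchParams

variable {P : SearchParams} {G : SimpleGraph P.Vtx} {w : Sym2 P.Vtx → ℕ}
  {L : List (P.Vtx × P.Vtx × ℕ)} {ctr : P.Ctr → P.Vtx} {a : SearchCtl P.n P.K}
  {T : P.Vtx × P.Ctr → PairData P.n}

/-- The state of the search while all levels of a scale are explored. -/
structure SearchState (G : SimpleGraph P.Vtx) (w : Sym2 P.Vtx → ℕ) (ctr : P.Ctr → P.Vtx)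
    (a : SearchCtl P.n P.K) (T : P.Vtx × P.Ctr → PairData P.n) : Prop where
  stage_eq : a.stage = 1
  ctr_eq : a.ctr = ctr
  tot_eq : a.tot = totalWeight G w
  scale_lt : a.scale < scales (totalWeight G w)
  round_le : a.round ≤ P.rounds
  chunk_eq : a.chunk = 0
  supported : Supported G (fun e => P.base * (P.h * P.E) * w e + 1) ctr fun k => (T k).2
  done : ScalesDone G w P.base P.h P.E ctr (fun k => (T k).2) a.scale
  inv : SearchInv G (fun e => scaleWeight P.base P.h P.E a.scale (w e)) ctr
    (fun k => (a.pend k).or (T k).1) a.lev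
  -- Every round is paid for, either by a new level or by `M` new entries.
  count : P.M * (a.round + 1) ≤ P.M * a.lev + supportCard fun k => (a.pend k).or (T k).1

/-- The state after the last search, while the predecessors are written. -/
structure OutputState (G : SimpleGraph P.Vtx) (w : Sym2 P.Vtx → ℕ) (ctr : P.Ctr → P.Vtx)
    (a : SearchCtl P.n P.K) (T : P.Vtx × P.Ctr → PairData P.n) : Prop where
  stage_eq : a.stage = 2
  ctr_eq : a.ctr = ctr
  supported : Supported G (fun e => P.base * (P.h * P.E) * w e + 1) ctr fun k => (T k).2
  done : ScalesDone G w P.base P.h P.E ctr (fun k => (T k).2) (scales (totalWeight G w))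
  mat_eq : ∀ y x, a.mat (y, x) = (T (ctr y, x)).2.map Prod.fst

lemma mem_cells_iff (hL : IsEdgeList G w L) {u v : P.Vtx} {k : ℕ} {x : P.Ctr} :
    (u, v, k, x) ∈ P.cells L ↔ G.Adj u v ∧ k = w s(u, v) :=
  mem_cells.trans (isEdgeList_mem_iff hL)

lemma searchState_init (ctr : P.Ctr → P.Vtx) :
    SearchState G w ctr { P.initCtl ctr with stage := 1, tot := totalWeight G w }
      fun _ => (none, none) where
  stage_eq := rfl
  ctr_eq := rfl
  tot_eq := rfl
  scale_lt := Nat.succ_pos _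
  round_le := Nat.zero_le _
  chunk_eq := rfl
  supported := by simp [Supported]
  done := by intro σ h; exact absurd h (Nat.not_lt_zero _)
  inv := searchInv_none fun _ => one_le_scaleWeight _ _ _ _ _
  count := Nat.le_add_right _ _

/-- The true state of the search is the stored table overlaid with the pending entries. A collecting
pass commits the old pending entries to the stream and gathers new ones against this overlaid table,
so the overlaid table only gains entries. -/
lemma SearchState.collect (H : SearchState G w ctr a T) (hL : IsEdgeList G w L)
    (hr : a.round < P.rounds) :
    let a' := (closePass a (endAcc a T (P.cells L) [])).1
    SearchState G w ctr a' (fun k => update a k (T k)) ∧ a'.scale = a.scale ∧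
      a'.round = a.round + 1 := by
  have h0 : ¬ a.stage = 0 := by rw [H.stage_eq]; decide
  have hclose : (closePass a (endAcc a T (P.cells L) [])).1 = { a with
          round := a.round + 1
          lev := if supportCard (endAcc a T (P.cells L) []).pend < P.M then a.lev + 1 else a.lev
          pend := (endAcc a T (P.cells L) []).pend } := by
    rw [closePass, if_neg h0, if_pos H.stage_eq, if_pos hr]
  intro a'
  have hupd : ∀ k d, update a k d = ((a.pend k).or d.1, d.2) := fun k d => if_pos hr
  set c := fun k => (a.pend k).or (T k).1 with hc
  set S := (endAcc a T (P.cells L) []).pend with hS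
  have hSfold : S = (P.cells L).foldl (fun f r => addUpTo P.M
      (CellEligible a r.1 r.2.1 r.2.2.1 r.2.2.2 (c (r.1, r.2.2.2)) (c (r.2.1, r.2.2.2)))
      (r.2.1, r.2.2.2) (a.lev, r.1) f) fun _ => none := by
    rw [hS, pend_endAcc]
    simp only [hupd, hc]
  have helig : ∀ u v x, CellEligible a u v (w s(u, v)) x (c (u, x)) (c (v, x)) ↔
      Eligible (fun e => scaleWeight P.base P.h P.E a.scale (w e)) ctr c a.lev u v x := by
    intro u v x
    rw [CellEligible, H.ctr_eq]
    rfl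
  have hSsome : ∀ v x l p, S (v, x) = some (l, p) → l = a.lev ∧ G.Adj p v ∧
      Eligible (fun e => scaleWeight P.base P.h P.E a.scale (w e)) ctr c a.lev p v x := by
    intro v x l p h
    rw [hSfold] at h
    rcases foldl_addUpTo_eq_some _ h with h | ⟨⟨u, v', k, x'⟩, hmem, hq, hkey, hval⟩
    · cases h
    · simp only [Prod.mk.injEq] at hkey hval
      obtain ⟨rfl, rfl⟩ := hkey
      obtain ⟨rfl, rfl⟩ := hval
      obtain ⟨hadj, rfl⟩ := (mem_cells_iff hL).mp hmem
      exact ⟨rfl, hadj, (helig _ _ _).mp hq⟩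
  have hSnone : ∀ k i, S k = some i → c k = none := by
    rintro ⟨v, x⟩ ⟨l, p⟩ h
    exact (hSsome v x l p h).2.2.2.1
  have hSM : supportCard S ≤ P.M := by
    rw [hSfold]
    exact foldl_addUpTo_card _ (by rw [supportCard_none]; exact Nat.zero_le _)
  have hSfull : supportCard S < P.M → ∀ u v x, G.Adj u v →
      Eligible (fun e => scaleWeight P.base P.h P.E a.scale (w e)) ctr c a.lev u v x →
      S (v, x) ≠ none := by
    intro hlt u v x hadj he
    rw [hSfold] at hlt ⊢
    exact foldl_addUpTo_ne_none (P.cells L) hlt (r := (u, v, w s(u, v), x))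
      ((mem_cells_iff hL).mpr ⟨hadj, rfl⟩) ((helig _ _ _).mpr he)
  have hT : (fun k => (a'.pend k).or (update a k (T k)).1) = fun k => (S k).or (c k) := by
    funext k
    rw [hupd]
    simp only [a', hclose, hc]
  refine ⟨⟨?_, ?_, ?_, ?_, ?_, ?_, ?_, ?_, ?_, ?_⟩, by simp only [a', hclose], by
    simp only [a', hclose]⟩
  · simp only [a', hclose, H.stage_eq]
  · simp only [a', hclose, H.ctr_eq]
  · simp only [a', hclose, H.tot_eq]
  · simp only [a', hclose, H.scale_lt]
  · simp only [a', hclose]; omega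
  · simp only [a', hclose, H.chunk_eq]
  · simp only [hupd]; exact H.supported
  · simp only [hupd, a', hclose]; exact H.done
  · rw [hT]
    simp only [a', hclose]
    refine H.inv.step (fun _ => one_le_scaleWeight _ _ _ _ _) ?_ ?_ ?_
    · intro k i hi
      rcases hSk : S k with _ | j
      · rw [Option.none_or]; exact hi
      · exact absurd hi (by rw [show (a.pend k).or (T k).1 = none from hSnone k j hSk]; simp)
    · intro v x l p hn hs
      refine hSsome v x l p ?_
      rw [show c (v, x) = none from hn, Option.or_none] at hs
      exact hs
    · split_ifs with hlt
      · refine Or.inr ⟨rfl, fun u v x hadj he => ?_⟩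
        obtain ⟨i, hi⟩ := Option.ne_none_iff_exists'.mp (hSfull hlt u v x hadj he)
        simp [hi]
      · exact Or.inl rfl
  -- If the level stays, the set of new entries has at least `M` elements, all at points that were
  -- free.
  · rw [hT, supportCard_or hSnone]
    have hcount : P.M * (a.round + 1) ≤ P.M * a.lev + supportCard c := H.count
    simp only [a', hclose]
    have e1 : P.M * (a.round + 1 + 1) = P.M * (a.round + 1) + P.M := by ring
    split_ifs with hlt
    · have e2 : P.M * (a.lev + 1) = P.M * a.lev + P.M := by ring
      omega
    · omega

/-- At most `n * (K + 1)` pairs can ever be entered, so at most `n * (K + 1) / M` rounds are spent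
without raising the level. -/
lemma SearchState.radius_lt (H : SearchState G w ctr a T) (hr : a.round = P.rounds) :
    P.radius < a.lev := by
  have h1 := H.count
  have h2 := supportCard_le fun k => (a.pend k).or (T k).1
  have h3 : Fintype.card (P.Vtx × P.Ctr) = P.n * (P.K + 1) := by simp
  have h4 := Nat.lt_mul_div_succ (P.n * (P.K + 1)) P.M_pos
  rw [h3] at h2
  rw [hr, rounds] at h1
  by_contra hle
  have h5 : P.M * a.lev ≤ P.M * P.radius := Nat.mul_le_mul_left _ (not_lt.mp hle)
  have h6 : P.M * (P.radius + P.n * (P.K + 1) / P.M + 1 + 1) = P.M * P.radius +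
    P.M * (P.n * (P.K + 1) / P.M + 1) + P.M := by ring
  omega

/-- Earlier scales survive because bounds only improve, and the finished search supplies the current
one since its level has passed the radius. -/
lemma SearchState.merge (H : SearchState G w ctr a T) (hr : a.round = P.rounds) :
    Supported G (fun e => P.base * (P.h * P.E) * w e + 1) ctr
        (fun k => (update a k (T k)).2) ∧
      ScalesDone G w P.base P.h P.E ctr (fun k => (update a k (T k)).2) (a.scale + 1) ∧
      ∀ k, (update a k (T k)).1 = none := by
  have hupd : ∀ k d, update a k d =
      (none, improve (scaleUnit P.base a.scale) d.2 ((a.pend k).or d.1)) :=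
    fun k d => if_neg (by omega)
  simp only [hupd]
  refine ⟨H.supported.improve H.inv.supported fun e =>
    le_scaleUnit_mul_scaleWeight (Nat.succ_pos _) _ _ _ _, ?_, fun _ => trivial⟩
  intro σ hσ
  rcases Nat.lt_succ_iff_lt_or_eq.mp hσ with h | rfl
  · exact (H.done σ h).improve_best _
  · exact (H.inv.chainBound (H.radius_lt hr)).improve_search

lemma SearchState.nextScale (H : SearchState G w ctr a T) (hr : a.round = P.rounds)
    (hs : a.scale + 1 < scales (totalWeight G w)) (b : SearchAcc P.n P.K P.M) :
    let a' := (closePass a b).1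
    SearchState G w ctr a' (fun k => update a k (T k)) ∧ a'.scale = a.scale + 1 ∧
      a'.round = 0 := by
  have h0 : ¬ a.stage = 0 := by rw [H.stage_eq]; decide
  have hclose : (closePass a b).1 =
      { a with scale := a.scale + 1, round := 0, lev := 1, pend := fun _ => none } := by
    rw [closePass, if_neg h0, if_pos H.stage_eq, if_neg (by omega), H.tot_eq, if_pos hs]
  intro a'
  obtain ⟨h1, h2, h3⟩ := H.merge hr
  refine ⟨⟨?_, ?_, ?_, ?_, ?_, ?_, h1, ?_, ?_, ?_⟩, by simp only [a', hclose], by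
    simp only [a', hclose]⟩
  · simp only [a', hclose, H.stage_eq]
  · simp only [a', hclose, H.ctr_eq]
  · simp only [a', hclose, H.tot_eq]
  · simp only [a', hclose, hs]
  · simp only [a', hclose, Nat.zero_le]
  · simp only [a', hclose, H.chunk_eq]
  · simp only [a', hclose, h2]
  · simp only [a', hclose, h3]
    exact searchInv_none fun _ => one_le_scaleWeight _ _ _ _ _
  · simp only [a', hclose]
    exact Nat.le_add_right _ _

lemma SearchState.toOutput (H : SearchState G w ctr a T) (hL : IsEdgeList G w L)
    (hr : a.round = P.rounds) (hs : ¬ a.scale + 1 < scales (totalWeight G w)) :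
    let a' := (closePass a (endAcc a T (P.cells L) [])).1
    OutputState G w ctr a' (fun k => update a k (T k)) ∧ a'.chunk = 0 := by
  have h0 : ¬ a.stage = 0 := by rw [H.stage_eq]; decide
  have hclose : (closePass a (endAcc a T (P.cells L) [])).1 =
      { a with stage := 2, pend := fun _ => none, mat := (endAcc a T (P.cells L) []).mat } := by
    rw [closePass, if_neg h0, if_pos H.stage_eq, if_neg (by omega), H.tot_eq, if_neg hs]
  have hscale : a.scale + 1 = scales (totalWeight G w) := by
    have := H.scale_lt
    omega
  intro a'
  obtain ⟨h1, h2, h3⟩ := H.merge hr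
  refine ⟨⟨by simp only [a', hclose], by simp only [a', hclose, H.ctr_eq], h1, hscale ▸ h2, ?_⟩,
    by simp only [a', hclose, H.chunk_eq]⟩
  intro y x
  simp only [a', hclose]
  rw [mat_endAcc, H.ctr_eq]
  set f : P.Cell → Option ℕ := fun c => if c.2.1 = ctr y ∧ c.2.2.2 = x then
    (update a (c.2.1, c.2.2.2) (T (c.2.1, c.2.2.2))).2.map Prod.fst else none with hf
  have hval : ∀ c g, f c = some g →
      (update a (ctr y, x) (T (ctr y, x))).2.map Prod.fst = some g := by
    intro c g hg
    simp only [hf] at hg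
    split_ifs at hg with h
    rw [h.1, h.2] at hg
    exact hg
  change (P.cells L).foldl (fun b c => optMin id b (f c)) none = _
  rcases hres : (P.cells L).foldl (fun b c => optMin id b (f c)) none with _ | g
  · symm
    rw [Option.map_eq_none_iff]
    by_contra hne
    obtain ⟨⟨e, p⟩, he⟩ := Option.ne_none_iff_exists'.mp hne
    -- A recorded bound has an adjacent predecessor, so there is a cell that shows it and the fold
    -- cannot have missed it.
    obtain ⟨-, hadj, -⟩ := h1 _ _ _ _ he
    have hmem : (p, ctr y, w s(p, ctr y), x) ∈ P.cells L := (mem_cells_iff hL).mpr ⟨hadj, rfl⟩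
    obtain ⟨g', hg', -⟩ := foldl_optMin_le (φ := id) (f := f) hmem
      (g := e) (by simp [hf, he]) none
    rw [hres] at hg'
    cases hg'
  · rcases foldl_optMin_eq_some hres with h | ⟨c, -, h⟩
    · cases h
    · exact (hval c g h).symm

/-- The last segment of a chain to `v` is recorded at a pair of `v`, which is visible in the cell of
its predecessor edge. Combined with the least chain value of its centre, it offers a candidate no
longer than the chain. -/
lemma OutputState.isChoice (H : OutputState G w ctr a T) (hL : IsEdgeList G w L) :
    IsChoice ctr (ctr 0) (fun k => (T k).2) (chosenPred a T (P.cells L)) := by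
  have hmat : ∀ x d, MatrixValue a.ctr (a.ctr 0) a.mat x d ↔
      ChainValue ctr (ctr 0) (fun k => (T k).2) (ctr x) d := by
    intro x d
    rw [H.ctr_eq]
    exact matrixValue_iff (b := fun k => (T k).2) H.mat_eq
  have hle : ∀ v, v ≠ ctr 0 → ∀ d, ChainValue ctr (ctr 0) (fun k => (T k).2) v d →
      ∃ g, (P.cells L).foldl (fun b c => optMin (candidateLength a) b
        (if v ≠ a.ctr 0 ∧ c.2.1 = v then candidate a c.2.2.2 (T (c.2.1, c.2.2.2)).2 else none))
        none = some g ∧ candidateLength a g ≤ d := by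
    intro v hv d hd
    cases hd with
    | source => exact absurd rfl hv
    | @step x d _ e p hd hb =>
      obtain ⟨-, hadj, -⟩ := H.supported _ _ _ _ hb
      have hmem : (p, v, w s(p, v), x) ∈ P.cells L := (mem_cells_iff hL).mpr ⟨hadj, rfl⟩
      obtain ⟨d', hd', hle⟩ := exists_leastValue ((hmat x d).mpr hd)
      have hcd : centreDist a x = some d' := hd'
      obtain ⟨g, hg, hgle⟩ := foldl_optMin_le (φ := candidateLength a)
        (f := fun c : P.Cell => if v ≠ a.ctr 0 ∧ c.2.1 = v then
          candidate a c.2.2.2 (T (c.2.1, c.2.2.2)).2 else none) hmem (g := (x, e, p))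
        (by simp [H.ctr_eq, hv, candidate, hcd, show (T (v, x)).2 = some (e, p) from hb]) none
      refine ⟨g, hg, hgle.trans ?_⟩
      -- Candidates arise only from centres with a known distance, so the default value in
      -- `candidateLength` is never used for them.
      simp only [candidateLength, hcd, Option.getD_some]
      omega
  constructor
  · intro v p hp
    rw [chosenPred, Option.map_eq_some_iff] at hp
    obtain ⟨g, hg, rfl⟩ := hp
    rcases foldl_optMin_eq_some hg with h | ⟨c, -, h⟩
    · cases h
    split_ifs at h with hcond
    obtain ⟨hv, hcv⟩ := hcond
    rw [H.ctr_eq] at hv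
    rw [candidate, Option.bind_eq_some_iff] at h
    obtain ⟨d, hd, h⟩ := h
    rw [Option.map_eq_some_iff] at h
    obtain ⟨i, hi, rfl⟩ := h
    refine ⟨hv, c.2.2.2, d, i.1, (hmat _ _).mp (leastValue_eq_some hd).1, hcv ▸ hi, ?_⟩
    intro d' hd'
    obtain ⟨g', hg', hle'⟩ := hle v hv d' hd'
    rw [hg] at hg'
    obtain rfl := Option.some.inj hg'
    simpa only [candidateLength, hd, Option.getD_some] using hle'
  · intro v d hv hd
    obtain ⟨g, hg, -⟩ := hle v hv d hd
    rw [chosenPred, hg]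
    simp

end SearchParams

end Correctness

/-! ### The whole run: passes, stream lengths and the final output. -/

section Run

namespace SearchParams

lemma mem_flatMap_chunkOutput {M n : ℕ} {pr : Fin n → Option (Fin n)} {v p : Fin n} {J : ℕ} :
    (v, p) ∈ (List.range J).flatMap (chunkOutput M pr) ↔ v.val / M < J ∧ pr v = some p := by
  simp only [List.mem_flatMap, List.mem_range, chunkOutput, List.mem_filterMap, List.mem_finRange,
    true_and]
  constructor
  · rintro ⟨j, hj, u, h⟩
    split_ifs at h with hu
    obtain ⟨q, hq, he⟩ := Option.map_eq_some_iff.mp h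
    obtain ⟨rfl, rfl⟩ := Prod.mk.inj he
    exact ⟨hu ▸ hj, hq⟩
  · rintro ⟨hj, hp⟩
    exact ⟨_, hj, v, by simp [hp]⟩

lemma chunkOutput_sublist {M n : ℕ} (pr : Fin n → Option (Fin n)) (j : ℕ) :
    ((chunkOutput M pr j).map Prod.fst).Sublist (List.finRange n) := by
  unfold chunkOutput
  induction List.finRange n with
  | nil => simp
  | cons v l ih =>
    rw [List.filterMap_cons]
    split
    · exact ih.cons _
    · next b hb =>
      split_ifs at hb
      obtain ⟨q, -, rfl⟩ := Option.map_eq_some_iff.mp hb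
      exact ih.cons_cons _

lemma nodup_flatMap_chunkOutput {M n : ℕ} (pr : Fin n → Option (Fin n)) (J : ℕ) :
    (((List.range J).flatMap (chunkOutput M pr)).map Prod.fst).Nodup := by
  rw [List.map_flatMap, List.nodup_flatMap]
  refine ⟨fun j _ => (chunkOutput_sublist pr j).nodup (List.nodup_finRange n), ?_⟩
  refine (List.nodup_range (n := J)).imp fun {i j} hij => ?_
  have key : ∀ j v, v ∈ (chunkOutput M pr j).map Prod.fst → v.val / M = j := by
    intro j v hv
    obtain ⟨⟨v', p⟩, hmem, rfl⟩ := List.mem_map.mp hv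
    obtain ⟨u, -, h⟩ := List.mem_filterMap.mp hmem
    split_ifs at h with hu
    obtain ⟨q, -, he⟩ := Option.map_eq_some_iff.mp h
    obtain ⟨rfl, rfl⟩ := Prod.mk.inj he
    exact hu
  intro v hi hj
  exact hij ((key i v hi).symm.trans (key j v hj))

variable {P : SearchParams} {G : SimpleGraph P.Vtx} {w : Sym2 P.Vtx → ℕ}
  {L : List (P.Vtx × P.Vtx × ℕ)} {ctr : P.Ctr → P.Vtx}

/-- The number of passes before the predecessors are written. -/
def searchPasses (P : SearchParams) (W : ℕ) : ℕ := 1 + scales W * (P.rounds + 1)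

/-- The number of passes. -/
def passes (P : SearchParams) (W : ℕ) : ℕ := P.searchPasses W + P.chunks

/-- A description of the control and the stream after `t ≥ 1` passes. -/
inductive Describes (P : SearchParams) (G : SimpleGraph P.Vtx) (w : Sym2 P.Vtx → ℕ)
    (L : List (P.Vtx × P.Vtx × ℕ)) (ctr : P.Ctr → P.Vtx) :
    ℕ → SearchCtl P.n P.K × List (SearchRec P.n P.K) → Prop
  | search {a T} (H : SearchState G w ctr a T) :
      Describes P G w L ctr (1 + a.scale * (P.rounds + 1) + a.round)
        (a, (P.cells L).map (cellRec T))
  | output {a T} (H : OutputState G w ctr a T) (hc : a.chunk ≤ P.chunks) :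
      Describes P G w L ctr (P.searchPasses (totalWeight G w) + a.chunk)
        (a, (if a.chunk < P.chunks then (P.cells L).map (cellRec T) else []) ++
          ((List.range a.chunk).flatMap (chunkOutput P.M (chosenPred a T (P.cells L)))).map
            fun r => SearchRec.pred r.1 r.2)

lemma Describes.next (hL : IsEdgeList G w L) {t : ℕ}
    {y : SearchCtl P.n P.K × List (SearchRec P.n P.K)} (H : Describes P G w L ctr t y)
    (ht : t < P.passes (totalWeight G w)) :
    Describes P G w L ctr (t + 1) (P.program.next y) := by
  cases H with
  | @search a T H =>
    rw [next_stage_one H.stage_eq]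
    rcases H.round_le.lt_or_eq with hr | hr
    · obtain ⟨h1, h2, h3⟩ := H.collect hL hr
      have := Describes.search (L := L) h1
      rw [h2, h3] at this
      exact this
    · by_cases hs : a.scale + 1 < scales (totalWeight G w)
      · obtain ⟨h1, h2, h3⟩ := H.nextScale hr hs (endAcc a T (P.cells L) [])
        have := Describes.search (L := L) h1
        rw [h2, h3] at this
        rw [hr]
        convert this using 1
        ring
      · obtain ⟨h1, h2⟩ := H.toOutput hL hr hs
        have := Describes.output (L := L) h1 (by omega)
        have hscale : a.scale + 1 = scales (totalWeight G w) := by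
          have := H.scale_lt
          omega
        rw [h2, if_pos (show 0 < P.chunks from Nat.succ_pos _), searchPasses, ← hscale] at this
        rw [hr]
        convert this using 1
        · ring
        · simp
  | @output a T H hc =>
    have hlt : a.chunk < P.chunks := by
      rw [passes] at ht
      omega
    rw [if_pos hlt, next_stage_two H.stage_eq]
    have hm : min P.chunks (a.chunk + 1) = a.chunk + 1 := by omega
    rw [hm]
    have H' : OutputState G w ctr { a with chunk := a.chunk + 1 } T :=
      ⟨H.stage_eq, H.ctr_eq, H.supported, H.done, H.mat_eq⟩
    have := Describes.output (L := L) H' (by simp only; omega)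
    simp only [List.range_succ, List.flatMap_append, List.flatMap_singleton] at this
    exact this

lemma describes_run (hL : IsEdgeList G w L) (hcap : totalWeight G w ≤ P.cap)
    (ctr : P.Ctr → P.Vtx) (t : ℕ) (ht : t < P.passes (totalWeight G w)) :
    Describes P G w L ctr (t + 1) (P.program.run (P.initCtl ctr) L (t + 1)) := by
  induction t with
  | zero =>
    rw [StreamProgram.run_succ, StreamProgram.run_zero, next_initCtl _ _
      (by rw [isEdgeList_sum hL]; exact hcap), isEdgeList_sum hL]
    convert Describes.search (L := L) (searchState_init (G := G) (w := w) ctr) using 1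
    simp [initCtl]
  | succ t ih =>
    rw [StreamProgram.run_succ]
    exact (ih (by omega)).next hL ht

/-- The final stream. -/
lemma run_passes (hL : IsEdgeList G w L) (hcap : totalWeight G w ≤ P.cap)
    (ctr : P.Ctr → P.Vtx) :
    ∃ a T, OutputState G w ctr a T ∧ P.program.run (P.initCtl ctr) L
      (P.passes (totalWeight G w)) = (a, ((List.range P.chunks).flatMap
        (chunkOutput P.M (chosenPred a T (P.cells L)))).map fun r => SearchRec.pred r.1 r.2) ∧
      P.chunks ≤ a.chunk := by
  have hpos : 0 < P.passes (totalWeight G w) := by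
    rw [passes, searchPasses]
    omega
  obtain ⟨t, ht⟩ : ∃ t, P.passes (totalWeight G w) = t + 1 := ⟨_, (Nat.succ_pred_eq_of_pos hpos).symm⟩
  have H := describes_run hL hcap ctr t (by omega)
  rw [← ht] at H
  generalize hy : P.program.run (P.initCtl ctr) L (P.passes (totalWeight G w)) = y at H
  generalize hk : P.passes (totalWeight G w) = k at H
  cases H with
  | @search a T H =>
    -- The search stage describes only pass numbers up to `searchPasses - 1`, whereas the run has
    -- `chunks ≥ 1` further passes.
    exfalso
    have h1 := H.scale_lt
    have h2 := H.round_le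
    have h3 : (a.scale + 1) * (P.rounds + 1) ≤ scales (totalWeight G w) * (P.rounds + 1) :=
      Nat.mul_le_mul_right _ h1
    rw [passes, searchPasses, chunks] at hk
    have h4 : (a.scale + 1) * (P.rounds + 1) = a.scale * (P.rounds + 1) + P.rounds + 1 := by ring
    generalize P.n / P.M = m at hk
    omega
  | @output a T H hc =>
    rw [passes] at hk
    have hc' : a.chunk = P.chunks := by omega
    refine ⟨a, T, H, ?_, hc'.ge⟩
    rw [if_neg (by omega), hc']
    rfl

lemma halted_run_passes (hL : IsEdgeList G w L) (hcap : totalWeight G w ≤ P.cap)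
    (ctr : P.Ctr → P.Vtx) :
    P.program.halted (P.program.run (P.initCtl ctr) L (P.passes (totalWeight G w))).1 = true := by
  obtain ⟨a, T, H, hrun, hc⟩ := run_passes hL hcap ctr
  rw [hrun]
  exact decide_eq_true ⟨H.stage_eq, hc⟩

lemma not_halted_run (hL : IsEdgeList G w L) (hcap : totalWeight G w ≤ P.cap)
    (ctr : P.Ctr → P.Vtx) (k : ℕ) (hk : k < P.passes (totalWeight G w)) :
    P.program.halted (P.program.run (P.initCtl ctr) L k).1 = false := by
  rcases k with _ | t
  · exact decide_eq_false (p := (0 : Fin 3) = 2 ∧ P.chunks ≤ 0) fun h => absurd h.1 (by decide)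
  · have H := describes_run hL hcap ctr t (by omega)
    generalize P.program.run (P.initCtl ctr) L (t + 1) = y at H
    generalize t + 1 = k at H hk
    cases H with
    | @search a T H =>
      refine decide_eq_false fun h => absurd (H.stage_eq.symm.trans h.1) (by decide)
    | @output a T H hc =>
      refine decide_eq_false fun h => ?_
      have h2 : P.chunks ≤ a.chunk := h.2
      rw [passes] at hk
      omega

lemma length_run_le (hL : IsEdgeList G w L) (hcap : totalWeight G w ≤ P.cap)
    (ctr : P.Ctr → P.Vtx) (k : ℕ) (hk : k ≤ P.passes (totalWeight G w)) :
    (P.program.run (P.initCtl ctr) L k).2.length ≤ L.length * ((P.K + 1) * 2) + P.n := by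
  rcases k with _ | t
  · rw [StreamProgram.run_zero, List.length_map]
    nlinarith
  · have H := describes_run hL hcap ctr t (by omega)
    generalize P.program.run (P.initCtl ctr) L (t + 1) = y at H
    generalize t + 1 = k at H
    cases H with
    | @search a T H =>
      simp only [List.length_map, length_cells]
      omega
    | @output a T H hc =>
      have h1 : ((List.range a.chunk).flatMap
          (chunkOutput P.M (chosenPred a T (P.cells L)))).length ≤ P.n := by
        have := (nodup_flatMap_chunkOutput (M := P.M) (chosenPred a T (P.cells L))
          a.chunk).length_le_card
        simpa using this
      have h2 : (if a.chunk < P.chunks then (P.cells L).map (cellRec T) else []).length ≤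
          L.length * ((P.K + 1) * 2) := by
        split_ifs
        · simp [length_cells]
        · simp
      simp only [List.length_append, List.length_map]
      omega

lemma run_represents {ε : ℝ} (hL : IsEdgeList G w L) (hcap : totalWeight G w ≤ P.cap)
    (hh : 1 ≤ P.h)
    (hε : ∀ a d : ℕ, d ≤ totalWeight G w → P.E * a ≤ (P.E + 2) * d → (a : ℝ) ≤ (1 + ε) * d)
    (hit : ∀ v, G.Reachable (ctr 0) v → ∃ Q : G.Walk (ctr 0) v, Q.IsPath ∧
      (∀ R : G.Walk (ctr 0) v, R.IsPath → walkLength w Q ≤ walkLength w R) ∧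
      HitsChain ctr P.h Q.getVert Q.length) :
    RepresentsApproxShortestPaths G w ε (ctr 0)
      ((P.program.run (P.initCtl ctr) L (P.passes (totalWeight G w))).2.map
        P.program.decode) := by
  obtain ⟨a, T, H, hrun, hc⟩ := run_passes hL hcap ctr
  have hmap : (P.program.run (P.initCtl ctr) L (P.passes (totalWeight G w))).2.map
      P.program.decode = (List.range P.chunks).flatMap
        (chunkOutput P.M (chosenPred a T (P.cells L))) := by
    rw [hrun]
    simp only [List.map_map]
    exact List.map_id _
  rw [hmap]
  refine representsApproxShortestPaths (B := P.base) (h := P.h) (E := P.E)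
    (by rw [Fintype.card_fin, base]; omega) hh hε H.done H.supported (H.isChoice hL) hit
    (nodup_flatMap_chunkOutput _ _) fun v p => ?_
  rw [mem_flatMap_chunkOutput]
  refine and_iff_right ?_
  rw [chunks]
  exact Nat.lt_succ_of_le (Nat.div_le_div_right v.isLt.le)

end SearchParams

end Run

/-! ### Counting the memory states and the records. -/

section Size

section PartialFunctions

variable {κ ι : Type} [Fintype κ] [DecidableEq κ]

open Classical in
/-- The partial functions with values in `I` that are defined at no more than `m` points. -/
noncomputable def partialFuns (I : Finset ι) : ℕ → Finset (κ → Option ι)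
  | 0 => {fun _ => none}
  | m + 1 => (partialFuns I m ×ˢ Finset.insertNone (Finset.univ ×ˢ I)).image fun y =>
      match y.2 with
      | none => y.1
      | some z => Function.update y.1 z.1 (some z.2)

/-- Such a function arises by `m` optional updates. Thus the pending entries need `O(M log n)` bits,
although their domain has `n * (K + 1)` points. -/
lemma card_partialFuns_le (I : Finset ι) (m : ℕ) :
    (partialFuns (κ := κ) I m).card ≤ (Fintype.card κ * I.card + 1) ^ m := by
  classical
  induction m with
  | zero => simp [partialFuns]
  | succ m ih =>
    refine Finset.card_image_le.trans ?_
    rw [Finset.card_product, Finset.card_insertNone, Finset.card_product, Finset.card_univ,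
      pow_succ]
    exact Nat.mul_le_mul_right _ ih

lemma mem_partialFuns {I : Finset ι} {m : ℕ} {f : κ → Option ι} (h : supportCard f ≤ m)
    (hI : ∀ k i, f k = some i → i ∈ I) : f ∈ partialFuns I m := by
  classical
  induction m generalizing f with
  | zero =>
    rw [partialFuns, Finset.mem_singleton]
    funext k
    have := Finset.card_eq_zero.mp (Nat.le_zero.mp h)
    simpa using Finset.filter_eq_empty_iff.mp this (Finset.mem_univ k)
  | succ m ih =>
    rw [partialFuns, Finset.mem_image]
    by_cases hex : ∃ k i, f k = some i
    · obtain ⟨k, i, hk⟩ := hex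
      set f₀ := Function.update f k none with hf₀
      have hf : Function.update f₀ k (some i) = f := by
        rw [hf₀, Function.update_idem, ← hk, Function.update_eq_self]
      have hcard := supportCard_update (f := f₀) (k := k) (by simp [hf₀]) i
      rw [hf] at hcard
      refine ⟨(f₀, some (k, i)), Finset.mem_product.mpr ⟨ih (f := f₀) (by omega) ?_, ?_⟩, hf⟩
      · intro k' i' h'
        by_cases hkk : k' = k
        · subst hkk; simp [hf₀] at h'
        · rw [hf₀, Function.update_of_ne hkk] at h'
          exact hI _ _ h'
      · rw [Finset.mem_insertNone]
        rintro z hz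
        obtain rfl := Option.some.inj hz
        exact Finset.mem_product.mpr ⟨Finset.mem_univ _, hI k i hk⟩
    · have h0 : f = fun _ => none := by
        funext k
        by_contra hne
        obtain ⟨i, hi⟩ := Option.ne_none_iff_exists'.mp hne
        exact hex ⟨k, i, hi⟩
      refine ⟨(f, none), Finset.mem_product.mpr ⟨ih ?_ hI, Finset.none_mem_insertNone⟩, rfl⟩
      rw [h0, supportCard_none]
      exact Nat.zero_le _

end PartialFunctions

namespace SearchParams

variable (P : SearchParams)

/-- A bound for the values that are recorded as best. -/
def valMax : ℕ := P.base * 2 ^ scales P.cap * (P.rounds + 1)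

def PendOK (f : P.Vtx × P.Ctr → Option (ℕ × P.Vtx)) : Prop :=
  supportCard f ≤ P.M ∧ ∀ k i, f k = some i → i.1 ≤ P.rounds + 1

def MatOK (m : P.Ctr × P.Ctr → Option ℕ) : Prop := ∀ k e, m k = some e → e ≤ P.valMax

def DataOK (d : PairData P.n) : Prop :=
  (∀ i, d.1 = some i → i.1 ≤ P.rounds + 1) ∧ ∀ i, d.2 = some i → i.1 ≤ P.valMax

/-- The condition `lev ≤ round + 1` bounds all recorded levels by `rounds + 1`, and so the merged
bounds by `valMax`. -/
structure CtlOK (a : SearchCtl P.n P.K) : Prop where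
  tot : a.tot ≤ P.cap
  scale : a.scale < scales P.cap
  round : a.round ≤ P.rounds
  lev : a.lev ≤ a.round + 1
  chunk : a.chunk ≤ P.chunks
  pend : P.PendOK a.pend
  mat : P.MatOK a.mat

structure AccOK (b : SearchAcc P.n P.K P.M) : Prop where
  tot : b.tot ≤ P.cap
  pend : P.PendOK b.pend
  mat : P.MatOK b.mat
  sel : ∀ i g, b.sel i = some g → g.2.1 ≤ P.valMax

def RecOK : SearchRec P.n P.K → Prop
  | .edge _ _ w => w ≤ P.cap
  | .cell _ _ w _ du dv => w ≤ P.cap ∧ P.DataOK du ∧ P.DataOK dv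
  | .pred _ _ => True

variable {P}

lemma scaleUnit_le {B σ k : ℕ} (hB : 1 ≤ B) (h : σ ≤ k) : scaleUnit B σ ≤ B * 2 ^ k := by
  cases σ with
  | zero => exact Nat.mul_pos hB (Nat.two_pow_pos k)
  | succ i => exact Nat.mul_le_mul_left _ (Nat.pow_le_pow_right (by norm_num) (by omega))

lemma PendOK.none : P.PendOK fun _ => none :=
  ⟨by rw [supportCard_none]; exact Nat.zero_le _, by simp⟩

lemma CtlOK.update {a : SearchCtl P.n P.K} (ha : P.CtlOK a) (k : P.Vtx × P.Ctr)
    {d : PairData P.n} (hd : P.DataOK d) : P.DataOK (update a k d) := by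
  have hor : ∀ i, (a.pend k).or d.1 = some i → i.1 ≤ P.rounds + 1 := by
    intro i hi
    rcases Option.or_eq_some_iff.mp hi with h | ⟨-, h⟩
    · exact ha.pend.2 _ _ h
    · exact hd.1 _ h
  unfold SearchParams.update
  split_ifs
  · exact ⟨hor, hd.2⟩
  · refine ⟨by simp, fun i hi => ?_⟩
    rcases optMin_eq_some hi with h | h
    · exact hd.2 _ h
    · obtain ⟨j, hj, rfl⟩ := Option.map_eq_some_iff.mp h
      exact Nat.mul_le_mul (scaleUnit_le (Nat.succ_pos _) ha.scale.le) (hor _ hj)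

lemma CtlOK.readRec {a : SearchCtl P.n P.K} (ha : P.CtlOK a) {b : SearchAcc P.n P.K P.M}
    (hb : P.AccOK b) {r : SearchRec P.n P.K} (hr : P.RecOK r) : P.AccOK (readRec a b r) := by
  cases r with
  | edge u v w => exact ⟨min_le_left _ _, hb.pend, hb.mat, hb.sel⟩
  | pred v p => exact hb
  | cell u v w x du dv =>
    obtain ⟨-, -, hdv⟩ := hr
    refine ⟨hb.tot, ⟨supportCard_addUpTo_le hb.pend.1, fun k i h => ?_⟩, fun k e h => ?_,
      fun i g h => ?_⟩
    · rcases addUpTo_eq_some h with h | ⟨-, -, rfl⟩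
      · exact hb.pend.2 _ _ h
      · exact ha.lev.trans (Nat.succ_le_succ ha.round)
    · rcases optMin_eq_some h with h | h
      · exact hb.mat _ _ h
      · split_ifs at h
        obtain ⟨j, hj, rfl⟩ := Option.map_eq_some_iff.mp h
        exact (ha.update _ hdv).2 _ hj
    · rcases optMin_eq_some h with h | h
      · exact hb.sel _ _ h
      · split_ifs at h
        obtain ⟨_, -, h⟩ := Option.bind_eq_some_iff.mp h
        obtain ⟨j, hj, rfl⟩ := Option.map_eq_some_iff.mp h
        exact hdv.2 _ hj

lemma CtlOK.writeRec {a : SearchCtl P.n P.K} (ha : P.CtlOK a) {r : SearchRec P.n P.K}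
    (hr : P.RecOK r) : ∀ r' ∈ writeRec a r, P.RecOK r' := by
  intro r' h
  have hnone : P.DataOK (none, none) := ⟨by simp, by simp⟩
  unfold SearchParams.writeRec at h
  split_ifs at h
  · cases r with
    | edge u v w =>
      simp only [List.mem_flatMap, List.mem_cons, List.not_mem_nil, or_false] at h
      obtain ⟨x, -, rfl | rfl⟩ := h <;> exact ⟨hr, hnone, hnone⟩
    | cell u v w x du dv => simp at h
    | pred v p => simp at h
  · cases r with
    | edge u v w => simp at h
    | cell u v w x du dv =>
      obtain rfl := List.mem_singleton.mp h
      exact ⟨hr.1, ha.update _ hr.2.1, ha.update _ hr.2.2⟩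
    | pred v p => simp at h
  all_goals
    cases r with
    | edge u v w => simp at h
    | cell u v w x du dv =>
      first
        | exact absurd h List.not_mem_nil
        | exact (List.mem_singleton.mp h) ▸ hr
    | pred v p =>
      obtain rfl := List.mem_singleton.mp h
      trivial

lemma CtlOK.closePass {a : SearchCtl P.n P.K} (ha : P.CtlOK a) {b : SearchAcc P.n P.K P.M}
    (hb : P.AccOK b) : P.CtlOK (closePass a b).1 := by
  have hs : scales a.tot ≤ scales P.cap :=
    Nat.add_le_add_right (Nat.clog_mono_right 2 ha.tot) 2
  unfold SearchParams.closePass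
  by_cases h0 : a.stage = 0
  · rw [if_pos h0]
    exact ⟨hb.tot, ha.scale, ha.round, ha.lev, ha.chunk, ha.pend, ha.mat⟩
  rw [if_neg h0]
  by_cases h1 : a.stage = 1
  · rw [if_pos h1]
    by_cases h2 : a.round < P.rounds
    · rw [if_pos h2]
      refine ⟨ha.tot, ha.scale, h2, ?_, ha.chunk, hb.pend, ha.mat⟩
      have := ha.lev
      simp only
      split_ifs <;> omega
    rw [if_neg h2]
    by_cases h3 : a.scale + 1 < scales a.tot
    · rw [if_pos h3]
      exact ⟨ha.tot, h3.trans_le hs, Nat.zero_le _, le_rfl, ha.chunk, .none, ha.mat⟩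
    · rw [if_neg h3]
      exact ⟨ha.tot, ha.scale, ha.round, ha.lev, ha.chunk, .none, hb.mat⟩
  · rw [if_neg h1]
    exact ⟨ha.tot, ha.scale, ha.round, ha.lev, min_le_left _ _, ha.pend, ha.mat⟩

lemma closePass_recOK {a : SearchCtl P.n P.K} {b : SearchAcc P.n P.K P.M} :
    ∀ r ∈ (closePass a b).2, P.RecOK r := by
  intro r h
  unfold SearchParams.closePass at h
  by_cases h0 : a.stage = 0
  · rw [if_pos h0] at h
    cases h
  rw [if_neg h0] at h
  by_cases h1 : a.stage = 1
  · rw [if_pos h1] at h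
    by_cases h2 : a.round < P.rounds
    · rw [if_pos h2] at h
      cases h
    rw [if_neg h2] at h
    by_cases h3 : a.scale + 1 < scales a.tot
    · rw [if_pos h3] at h
      cases h
    · rw [if_neg h3] at h
      cases h
  · rw [if_neg h1] at h
    obtain ⟨v, -, h⟩ := List.mem_filterMap.mp h
    split_ifs at h
    obtain ⟨g, -, rfl⟩ := Option.map_eq_some_iff.mp h
    trivial

lemma initCtl_ok (ctr : P.Ctr → P.Vtx) : P.CtlOK (P.initCtl ctr) :=
  ⟨Nat.zero_le _, Nat.succ_pos _, Nat.zero_le _, le_rfl, Nat.zero_le _, .none,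
    fun _ _ h => by cases h⟩

lemma initAcc_ok : P.AccOK P.program.init :=
  ⟨Nat.zero_le _, .none, fun _ _ h => (by cases h), fun _ _ h => (by cases h)⟩

open Finset

variable (P)

noncomputable def pendSet : Finset (P.Vtx × P.Ctr → Option (ℕ × P.Vtx)) :=
  partialFuns (range (P.rounds + 2) ×ˢ univ) P.M

noncomputable def matSet : Finset (P.Ctr × P.Ctr → Option ℕ) :=
  Fintype.piFinset fun _ => insertNone (range (P.valMax + 1))

def dataSet : Finset (PairData P.n) :=
  insertNone (range (P.rounds + 2) ×ˢ univ) ×ˢ insertNone (range (P.valMax + 1) ×ˢ univ)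

variable {P}

lemma PendOK.mem {f : P.Vtx × P.Ctr → Option (ℕ × P.Vtx)} (h : P.PendOK f) : f ∈ P.pendSet :=
  mem_partialFuns h.1 fun k i hi => mem_product.mpr
    ⟨mem_range.mpr (Nat.lt_succ_of_le (h.2 k i hi)), mem_univ _⟩

lemma MatOK.mem {m : P.Ctr × P.Ctr → Option ℕ} (h : P.MatOK m) : m ∈ P.matSet :=
  Fintype.mem_piFinset.mpr fun k => mem_insertNone.mpr fun e he =>
    mem_range.mpr (Nat.lt_succ_of_le (h k e he))

lemma DataOK.mem {d : PairData P.n} (h : P.DataOK d) : d ∈ P.dataSet :=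
  mem_product.mpr ⟨mem_insertNone.mpr fun i hi => mem_product.mpr
      ⟨mem_range.mpr (Nat.lt_succ_of_le (h.1 i hi)), mem_univ _⟩,
    mem_insertNone.mpr fun i hi => mem_product.mpr
      ⟨mem_range.mpr (Nat.lt_succ_of_le (h.2 i hi)), mem_univ _⟩⟩

open Classical in
lemma exists_ctlSet (P : SearchParams) : ∃ S : Finset (SearchCtl P.n P.K), (∀ a, a ∈ S ↔ P.CtlOK a) ∧
    #S ≤ P.n ^ (P.K + 1) * (3 * ((P.cap + 1) * (scales P.cap * ((P.rounds + 1) *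
      ((P.rounds + 2) * ((P.chunks + 1) * (#P.pendSet * #P.matSet))))))) := by
  let S : Finset (SearchCtl P.n P.K) := ((univ : Finset (P.Ctr → P.Vtx)) ×ˢ
    (univ : Finset (Fin 3)) ×ˢ range (P.cap + 1) ×ˢ range (scales P.cap) ×ˢ
    range (P.rounds + 1) ×ˢ range (P.rounds + 2) ×ˢ range (P.chunks + 1) ×ˢ P.pendSet ×ˢ
    P.matSet).image fun y => ⟨y.1, y.2.1, y.2.2.1, y.2.2.2.1, y.2.2.2.2.1, y.2.2.2.2.2.1,
      y.2.2.2.2.2.2.1, y.2.2.2.2.2.2.2.1, y.2.2.2.2.2.2.2.2⟩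
  refine ⟨S.filter P.CtlOK, fun a => ?_, (card_filter_le _ _).trans (card_image_le.trans ?_)⟩
  · rw [mem_filter]
    refine and_iff_right_of_imp fun h => mem_image.mpr ⟨(a.ctr, a.stage, a.tot, a.scale, a.round,
      a.lev, a.chunk, a.pend, a.mat), ?_, rfl⟩
    have h1 := h.lev
    have h2 := h.round
    simp only [mem_product, mem_univ, true_and, mem_range]
    exact ⟨Nat.lt_succ_of_le h.tot, h.scale, Nat.lt_succ_of_le h.round, by omega,
      Nat.lt_succ_of_le h.chunk, h.pend.mem, h.mat.mem⟩
  · simp [card_product]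

open Classical in
lemma exists_accSet (P : SearchParams) :
    ∃ S : Finset (SearchAcc P.n P.K P.M), (∀ a, a ∈ S ↔ P.AccOK a) ∧
      #S ≤ (P.cap + 1) * (#P.pendSet * (#P.matSet *
        ((P.K + 1) * ((P.valMax + 1) * P.n) + 1) ^ P.M)) := by
  let S : Finset (SearchAcc P.n P.K P.M) := (range (P.cap + 1) ×ˢ P.pendSet ×ˢ P.matSet ×ˢ
    (Fintype.piFinset fun _ : Fin P.M => insertNone ((univ : Finset P.Ctr) ×ˢ
      range (P.valMax + 1) ×ˢ (univ : Finset P.Vtx)))).image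
      fun y => ⟨y.1, y.2.1, y.2.2.1, y.2.2.2⟩
  refine ⟨S.filter P.AccOK, fun a => ?_, (card_filter_le _ _).trans (card_image_le.trans ?_)⟩
  · rw [mem_filter]
    refine and_iff_right_of_imp fun h => mem_image.mpr ⟨(a.tot, a.pend, a.mat, a.sel), ?_, rfl⟩
    simp only [mem_product, mem_univ, true_and, mem_range, Fintype.mem_piFinset, mem_insertNone,
      and_true]
    exact ⟨Nat.lt_succ_of_le h.tot, h.pend.mem, h.mat.mem, fun i g hg =>
      Nat.lt_succ_of_le (h.sel i g hg)⟩
  · simp [card_product]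

open Classical in
lemma exists_recSet (P : SearchParams) :
    ∃ S : Finset (SearchRec P.n P.K), (∀ a, a ∈ S ↔ P.RecOK a) ∧
      #S ≤ P.n * (P.n * (P.cap + 1)) + P.n * (P.n * ((P.cap + 1) * ((P.K + 1) *
        (#P.dataSet * #P.dataSet)))) + P.n * P.n := by
  let S₁ : Finset (SearchRec P.n P.K) := ((univ : Finset P.Vtx) ×ˢ (univ : Finset P.Vtx) ×ˢ
    range (P.cap + 1)).image fun y => .edge y.1 y.2.1 y.2.2
  let S₂ : Finset (SearchRec P.n P.K) := ((univ : Finset P.Vtx) ×ˢ (univ : Finset P.Vtx) ×ˢ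
    range (P.cap + 1) ×ˢ (univ : Finset P.Ctr) ×ˢ P.dataSet ×ˢ P.dataSet).image
      fun y => .cell y.1 y.2.1 y.2.2.1 y.2.2.2.1 y.2.2.2.2.1 y.2.2.2.2.2
  let S₃ : Finset (SearchRec P.n P.K) := ((univ : Finset P.Vtx) ×ˢ
    (univ : Finset P.Vtx)).image fun y => .pred y.1 y.2
  refine ⟨(S₁ ∪ S₂ ∪ S₃).filter P.RecOK, fun a => ?_, (card_filter_le _ _).trans
    ((card_union_le _ _).trans (Nat.add_le_add ((card_union_le _ _).trans
      (Nat.add_le_add (card_image_le.trans ?_) (card_image_le.trans ?_)))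
      (card_image_le.trans ?_)))⟩
  · rw [mem_filter]
    refine and_iff_right_of_imp fun h => ?_
    cases a with
    | edge u v w =>
      refine mem_union_left _ (mem_union_left _ (mem_image.mpr ⟨(u, v, w), ?_, rfl⟩))
      simp only [mem_product, mem_univ, true_and, mem_range]
      exact Nat.lt_succ_of_le h
    | cell u v w x du dv =>
      refine mem_union_left _ (mem_union_right _ (mem_image.mpr ⟨(u, v, w, x, du, dv), ?_, rfl⟩))
      simp only [mem_product, mem_univ, true_and, mem_range]
      exact ⟨Nat.lt_succ_of_le h.1, h.2.1.mem, h.2.2.mem⟩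
    | pred v p =>
      exact mem_union_right _ (mem_image.mpr ⟨(v, p), by simp, rfl⟩)
  all_goals simp [card_product]

/-- The program never leaves its finite sets of states and records. -/
noncomputable def bound (P : SearchParams) : P.program.Bound where
  ctl := (exists_ctlSet P).choose
  acc := (exists_accSet P).choose
  recs := (exists_recSet P).choose
  encode_mem _ := ((exists_recSet P).choose_spec.1 _).mpr (min_le_left _ _)
  init_mem := ((exists_accSet P).choose_spec.1 _).mpr
    initAcc_ok
  read_mem _ hc _ ha _ hr := ((exists_accSet P).choose_spec.1 _).mpr
    (CtlOK.readRec (((exists_ctlSet P).choose_spec.1 _).mp hc)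
      (((exists_accSet P).choose_spec.1 _).mp ha) (((exists_recSet P).choose_spec.1 _).mp hr))
  write_mem _ hc _ hr r' hr' := ((exists_recSet P).choose_spec.1 _).mpr
    (CtlOK.writeRec (((exists_ctlSet P).choose_spec.1 _).mp hc)
      (((exists_recSet P).choose_spec.1 _).mp hr) r' hr')
  close_ctl _ hc _ ha := ((exists_ctlSet P).choose_spec.1 _).mpr
    (CtlOK.closePass (((exists_ctlSet P).choose_spec.1 _).mp hc)
      (((exists_accSet P).choose_spec.1 _).mp ha))
  close_recs _ _ _ _ r hr := ((exists_recSet P).choose_spec.1 _).mpr (closePass_recOK r hr)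

lemma initCtl_mem (ctr : P.Ctr → P.Vtx) : P.initCtl ctr ∈ P.bound.ctl :=
  ((exists_ctlSet P).choose_spec.1 _).mpr (initCtl_ok ctr)

/-- All the parameters are at most `q`. -/
structure BoundedBy (P : SearchParams) (q : ℕ) : Prop where
  two : 2 ≤ q
  n : P.n ≤ q
  K : P.K + 1 ≤ q
  cap : P.cap + 1 ≤ q
  scales : scales P.cap ≤ q
  rounds : P.rounds + 2 ≤ q
  chunks : P.chunks + 1 ≤ q
  valMax : P.valMax + 1 < q

lemma succ_le_pow_succ {x q k : ℕ} (hq : 2 ≤ q) (h : x ≤ q ^ k) : x + 1 ≤ q ^ (k + 1) := by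
  have : 1 ≤ q ^ k := Nat.one_le_pow _ _ (by omega)
  rw [pow_succ]
  nlinarith

variable {q : ℕ}

lemma BoundedBy.pendSet (h : P.BoundedBy q) : #P.pendSet ≤ q ^ (5 * P.M) := by
  refine (card_partialFuns_le _ _).trans ?_
  rw [pow_mul]
  refine Nat.pow_le_pow_left (succ_le_pow_succ h.two ?_) _
  simp only [Fintype.card_prod, Fintype.card_fin, card_product, card_range, card_univ]
  calc P.n * (P.K + 1) * ((P.rounds + 2) * P.n) ≤ q * q * (q * q) :=
        Nat.mul_le_mul (Nat.mul_le_mul h.n h.K) (Nat.mul_le_mul h.rounds h.n)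
    _ = q ^ 4 := by ring

/-- The matrix is a full table; it fits because `K` is about `√M`, which makes the number of its
entries `O(M)`. -/
lemma BoundedBy.matSet (h : P.BoundedBy q) (hK : (P.K + 1) * (P.K + 1) ≤ 4 * P.M) :
    #P.matSet ≤ q ^ (4 * P.M) := by
  rw [SearchParams.matSet, Fintype.card_piFinset, prod_const, card_insertNone, card_range,
    card_univ, Fintype.card_prod, Fintype.card_fin]
  exact (Nat.pow_le_pow_left h.valMax _).trans
    (Nat.pow_le_pow_right (by have := h.two; omega) hK)

lemma BoundedBy.dataSet (h : P.BoundedBy q) : #P.dataSet ≤ q ^ 6 := by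
  rw [SearchParams.dataSet, card_product, card_insertNone, card_insertNone, card_product,
    card_product, card_range, card_range, card_univ, Fintype.card_fin]
  have h1 : (P.rounds + 2) * P.n ≤ q ^ 2 := by
    rw [sq]; exact Nat.mul_le_mul h.rounds h.n
  have h2 : (P.valMax + 1) * P.n ≤ q ^ 2 := by
    rw [sq]; exact Nat.mul_le_mul h.valMax.le h.n
  calc _ ≤ q ^ 3 * q ^ 3 :=
        Nat.mul_le_mul (succ_le_pow_succ h.two h1) (succ_le_pow_succ h.two h2)
    _ = q ^ 6 := by ring

lemma BoundedBy.card_ctl (h : P.BoundedBy q) (hK : (P.K + 1) * (P.K + 1) ≤ 4 * P.M)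
    (hKM : P.K + 1 ≤ 2 * P.M) : #P.bound.ctl ≤ q ^ (18 * P.M) := by
  have hq : 1 ≤ q := by have := h.two; omega
  have h3 : 3 ≤ q ^ 2 := by have := h.two; nlinarith
  have h1 : P.n ^ (P.K + 1) ≤ q ^ (2 * P.M) :=
    (Nat.pow_le_pow_left h.n _).trans (Nat.pow_le_pow_right hq hKM)
  refine (exists_ctlSet P).choose_spec.2.trans ?_
  calc _ ≤ q ^ (2 * P.M) * (q ^ 2 * (q * (q * (q * (q * (q *
        (q ^ (5 * P.M) * q ^ (4 * P.M)))))))) := by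
        refine Nat.mul_le_mul h1 (Nat.mul_le_mul h3 (Nat.mul_le_mul h.cap (Nat.mul_le_mul h.scales
          (Nat.mul_le_mul (by have := h.rounds; omega) (Nat.mul_le_mul h.rounds
          (Nat.mul_le_mul h.chunks (Nat.mul_le_mul h.pendSet (h.matSet hK))))))))
    _ = q ^ (11 * P.M + 7) := by ring
    _ ≤ _ := Nat.pow_le_pow_right hq (by have := P.M_pos; omega)

lemma BoundedBy.card_acc (h : P.BoundedBy q) (hK : (P.K + 1) * (P.K + 1) ≤ 4 * P.M) :
    #P.bound.acc ≤ q ^ (14 * P.M) := by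
  have hq : 1 ≤ q := by have := h.two; omega
  have h1 : ((P.K + 1) * ((P.valMax + 1) * P.n) + 1) ^ P.M ≤ q ^ (4 * P.M) := by
    rw [pow_mul]
    refine Nat.pow_le_pow_left (succ_le_pow_succ h.two ?_) _
    calc _ ≤ q * (q * q) := Nat.mul_le_mul h.K (Nat.mul_le_mul h.valMax.le h.n)
      _ = q ^ 3 := by ring
  refine (exists_accSet P).choose_spec.2.trans ?_
  calc _ ≤ q * (q ^ (5 * P.M) * (q ^ (4 * P.M) * q ^ (4 * P.M))) :=
        Nat.mul_le_mul h.cap (Nat.mul_le_mul h.pendSet (Nat.mul_le_mul (h.matSet hK) h1))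
    _ = q ^ (13 * P.M + 1) := by ring
    _ ≤ _ := Nat.pow_le_pow_right hq (by have := P.M_pos; omega)

lemma BoundedBy.card_recs (h : P.BoundedBy q) : #P.bound.recs ≤ q ^ 18 := by
  have hq : 1 ≤ q := by have := h.two; omega
  have h3 : 3 ≤ q ^ 2 := by have := h.two; nlinarith
  refine (exists_recSet P).choose_spec.2.trans ?_
  calc _ ≤ q * (q * q) + q * (q * (q * (q * (q ^ 6 * q ^ 6)))) + q * q := by
        refine Nat.add_le_add (Nat.add_le_add
          (Nat.mul_le_mul h.n (Nat.mul_le_mul h.n h.cap))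
          (Nat.mul_le_mul h.n (Nat.mul_le_mul h.n (Nat.mul_le_mul h.cap (Nat.mul_le_mul h.K
            (Nat.mul_le_mul h.dataSet h.dataSet))))))
          (Nat.mul_le_mul h.n h.n)
    _ = q ^ 3 + q ^ 16 + q ^ 2 := by ring
    _ ≤ q ^ 16 + q ^ 16 + q ^ 16 := by gcongr <;> omega
    _ = 3 * q ^ 16 := by ring
    _ ≤ q ^ 2 * q ^ 16 := Nat.mul_le_mul_right _ h3
    _ = _ := by ring

end SearchParams

end Size

/-! ### Choice of the parameters and the number of passes. -/

section Main

namespace SearchParams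

/-- The number of sampled centres, for memory parameter `M`, is `⌊√M⌋`; the hop bound is a multiple
of `n * log n / K`. -/
noncomputable def ofInput (c A n M : ℕ) (ε : ℝ) (hM : 1 ≤ M) : SearchParams where
  n := n
  K := M.sqrt
  M := M
  h := A * (n * Nat.clog 2 n / M.sqrt + 1)
  E := 2 * min ⌈1 / ε⌉₊ (n ^ c + 1)
  cap := n ^ c
  M_pos := hM

/-- Halving `E` leaves `e * a ≤ (e + 1) * d`. Either `1 / e ≤ ε`, or the cap is active and `e > d`,
so that integrality gives `a ≤ d`. -/
lemma le_of_precision {c n : ℕ} {ε : ℝ} (hε : 0 < ε) {a d : ℕ} (hd : d ≤ n ^ c)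
    (h : 2 * min ⌈1 / ε⌉₊ (n ^ c + 1) * a ≤ (2 * min ⌈1 / ε⌉₊ (n ^ c + 1) + 2) * d) :
    (a : ℝ) ≤ (1 + ε) * d := by
  set e := min ⌈1 / ε⌉₊ (n ^ c + 1) with he
  have h' : e * a ≤ e * d + d := by nlinarith
  rcases le_total ⌈1 / ε⌉₊ (n ^ c + 1) with hle | hle
  · rw [min_eq_left hle] at he
    have h1 : 1 / ε ≤ e := by rw [he]; exact Nat.le_ceil _
    have h2 : (e : ℝ) * a ≤ e * d + d := by exact_mod_cast h'
    have h3 : 0 < (e : ℝ) := lt_of_lt_of_le (by positivity) h1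
    have h4 : 1 ≤ ε * e := by
      rw [div_le_iff₀ hε] at h1; linarith
    have h5 : (d : ℝ) ≤ ε * e * d := le_mul_of_one_le_left (Nat.cast_nonneg d) h4
    refine le_of_mul_le_mul_left ?_ h3
    calc (e : ℝ) * a ≤ e * d + ε * e * d := by linarith
      _ = e * ((1 + ε) * d) := by ring
  · rw [min_eq_right hle] at he
    have h1 : e * a < e * (d + 1) := by
      rw [mul_add, mul_one]; omega
    have h2 : a ≤ d := Nat.lt_succ_iff.mp (Nat.lt_of_mul_lt_mul_left h1)
    have h3 : (a : ℝ) ≤ d := by exact_mod_cast h2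
    nlinarith [mul_nonneg hε.le (Nat.cast_nonneg (α := ℝ) d)]

lemma precision_le {c n : ℕ} {ε : ℝ} (hε : 0 < ε) :
    ((2 * min ⌈1 / ε⌉₊ (n ^ c + 1) : ℕ) : ℝ) ≤ 2 * ((1 + ε) / ε) := by
  have h1 : (⌈1 / ε⌉₊ : ℝ) < 1 / ε + 1 := Nat.ceil_lt_add_one (by positivity)
  have h2 : ((min ⌈1 / ε⌉₊ (n ^ c + 1) : ℕ) : ℝ) ≤ ⌈1 / ε⌉₊ := by exact_mod_cast min_le_left _ _
  have h3 : (1 + ε) / ε = 1 / ε + 1 := by field_simp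
  push_cast at h2 ⊢
  rw [h3]
  linarith

lemma sqrt_pos_of_pos {M : ℕ} (hM : 1 ≤ M) : 1 ≤ M.sqrt := Nat.sqrt_pos.mpr hM

lemma add_one_le_pow {n x k : ℕ} (hn : 2 ≤ n) (h : x ≤ n ^ k) : x + 1 ≤ n ^ (k + 1) :=
  succ_le_pow_succ hn h

/-- The cap on `E` makes all quantities polynomial in `n`, uniformly in `ε`. -/
lemma boundedBy_ofInput {c A n M : ℕ} {ε : ℝ} (hn : 2 ≤ n) (hM : 1 ≤ M) (hMn : M ≤ n ^ 2) :
    (ofInput c A n M ε hM).BoundedBy (n ^ (A + 2 * c + 17)) := by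
  set P := ofInput c A n M ε hM with hP
  have hn1 : 1 ≤ n := by omega
  have mono : ∀ {x k : ℕ}, x ≤ n ^ k → k ≤ A + 2 * c + 17 → x ≤ n ^ (A + 2 * c + 17) :=
    fun hx hk => hx.trans (Nat.pow_le_pow_right hn1 hk)
  have hK : P.K ≤ n := by
    have : P.K ≤ Nat.sqrt (n ^ 2) := Nat.sqrt_le_sqrt hMn
    rwa [Nat.sqrt_eq'] at this
  have hK1 : P.K + 1 ≤ n ^ 2 := add_one_le_pow hn (by rwa [pow_one])
  have hcap : P.cap + 1 ≤ n ^ (c + 1) := add_one_le_pow hn le_rfl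
  have hclog : ∀ x, Nat.clog 2 x ≤ x := fun x => Nat.clog_le_of_le_pow Nat.lt_two_pow_self.le
  have hscales : scales P.cap ≤ n ^ (c + 2) := by
    have h1 := hclog (n ^ c)
    have h2 : P.cap + 1 + 1 ≤ n ^ (c + 1 + 1) := add_one_le_pow hn hcap
    change Nat.clog 2 (n ^ c) + 2 ≤ _
    change n ^ c + 1 + 1 ≤ n ^ (c + 2) at h2
    omega
  have hA : A ≤ n ^ A := Nat.lt_two_pow_self.le.trans (Nat.pow_le_pow_left hn A)
  have hh : P.h ≤ n ^ (A + 3) := by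
    have h1 : n * Nat.clog 2 n / M.sqrt ≤ n ^ 2 := by
      rw [sq]
      exact (Nat.div_le_self _ _).trans (Nat.mul_le_mul_left _ (hclog n))
    rw [pow_add]
    exact Nat.mul_le_mul hA (add_one_le_pow hn h1)
  have hE : P.E ≤ n ^ (c + 2) := by
    have h1 : min ⌈1 / ε⌉₊ (n ^ c + 1) ≤ n ^ (c + 1) := (min_le_right _ _).trans hcap
    rw [pow_succ n (c + 1), mul_comm (n ^ (c + 1)) n]
    exact Nat.mul_le_mul hn h1
  have hradius : P.radius ≤ n ^ (A + c + 6) := by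
    have h1 : P.radius = P.h * (P.E + 1) := by rw [radius]; ring
    rw [h1, show A + c + 6 = A + 3 + (c + 2 + 1) by ring, pow_add]
    exact Nat.mul_le_mul hh (add_one_le_pow hn hE)
  have hrounds : P.rounds + 2 ≤ n ^ (A + c + 10) := by
    have h1 : P.n * (P.K + 1) / P.M ≤ n ^ (A + c + 6) := by
      refine (Nat.div_le_self _ _).trans ?_
      calc n * (P.K + 1) ≤ n * n ^ 2 := Nat.mul_le_mul_left _ hK1
        _ = n ^ 3 := by ring
        _ ≤ _ := Nat.pow_le_pow_right hn1 (by omega)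
    have h2 : P.radius + P.n * (P.K + 1) / P.M ≤ n ^ (A + c + 7) := by
      rw [show A + c + 7 = A + c + 6 + 1 by ring, pow_succ]
      have := Nat.mul_le_mul_left (n ^ (A + c + 6)) hn
      omega
    exact add_one_le_pow hn (add_one_le_pow hn (add_one_le_pow hn h2))
  have hchunks : P.chunks + 1 ≤ n ^ 3 := by
    have h1 : P.n / P.M ≤ n ^ 1 := by
      rw [pow_one]
      exact Nat.div_le_self _ _
    exact add_one_le_pow hn (add_one_le_pow hn h1)
  have hval : P.valMax + 2 ≤ n ^ (A + 2 * c + 15 + 2) := by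
    have h1 : 2 ^ scales P.cap ≤ n ^ (c + 3) := by
      have h2 := two_pow_clog_le (Nat.one_le_pow c n hn1)
      have h3 : 2 ^ 3 ≤ n ^ 3 := Nat.pow_le_pow_left hn 3
      change 2 ^ (Nat.clog 2 (n ^ c) + 2) ≤ _
      rw [pow_add, pow_add n]
      calc _ ≤ 2 * n ^ c * 2 ^ 2 := Nat.mul_le_mul_right _ h2
        _ = n ^ c * 2 ^ 3 := by ring
        _ ≤ _ := Nat.mul_le_mul_left _ h3
    have h2 : P.base ≤ n ^ 2 := add_one_le_pow hn (by rw [pow_one]; exact le_rfl)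
    refine add_one_le_pow hn (add_one_le_pow hn ?_)
    rw [valMax]
    calc _ ≤ n ^ 2 * n ^ (c + 3) * n ^ (A + c + 10) :=
          Nat.mul_le_mul (Nat.mul_le_mul h2 h1) (by omega)
      _ = n ^ (A + 2 * c + 15) := by ring
  exact
    { two := mono (k := 1) (by rwa [pow_one]) (by omega)
      n := mono (k := 1) (by rw [pow_one]; exact le_rfl) (by omega)
      K := mono hK1 (by omega)
      cap := mono hcap (by omega)
      scales := mono hscales (by omega)
      rounds := mono hrounds (by omega)
      chunks := mono hchunks (by omega)
      valMax := hval }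

lemma clog_le_logb {m : ℕ} : (Nat.clog 2 m : ℝ) ≤ Real.logb 2 (max 2 (m : ℝ)) + 1 := by
  have h0 : 0 ≤ Real.logb 2 (max 2 (m : ℝ)) :=
    Real.logb_nonneg (by norm_num) (le_max_of_le_left (by norm_num))
  have h1 : (Nat.clog 2 m : ℝ) ≤ (⌈Real.logb 2 (max 2 (m : ℝ))⌉₊ : ℕ) := by
    have h2 : (max 2 (m : ℝ)) = ((max 2 m : ℕ) : ℝ) := by push_cast; rfl
    rw [h2]
    have h3 := Real.natCeil_logb_natCast 2 (max 2 m)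
    rw [Nat.cast_ofNat] at h3
    rw [h3]
    exact_mod_cast Nat.clog_mono_right 2 (le_max_right 2 m)
  exact h1.trans (Nat.ceil_lt_add_one h0).le

lemma passes_ofInput_le {c A n M : ℕ} {ε : ℝ} (hn : 2 ≤ n) (hM : 1 ≤ M) (hMn : M ≤ n ^ 2)
    (hε : 0 < ε) (hA : 1 ≤ A) (W : ℕ) :
    ((ofInput c A n M ε hM).passes W : ℝ) ≤ (110 * A : ℕ) * ((1 + ε) * n * Real.logb 2 n *
      Real.logb 2 (max 2 (W : ℝ)) / (ε * √(M : ℝ))) := by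
  set P := ofInput c A n M ε hM with hP
  set l := Real.logb 2 n with hl
  set lw := Real.logb 2 (max 2 (W : ℝ)) with hlw
  set Z := (1 + ε) / ε with hZ
  have hA' : (1 : ℝ) ≤ A := by exact_mod_cast hA
  have hn' : (2 : ℝ) ≤ n := by exact_mod_cast hn
  have hKM : M.sqrt * M.sqrt ≤ M := Nat.sqrt_le M
  have hK1 : 1 ≤ M.sqrt := sqrt_pos_of_pos hM
  have hKn : M.sqrt ≤ n := by
    have : M.sqrt ≤ Nat.sqrt (n ^ 2) := Nat.sqrt_le_sqrt hMn
    rwa [Nat.sqrt_eq'] at this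
  set K : ℝ := ((M.sqrt : ℕ) : ℝ) with hK
  have hK1' : 1 ≤ K := by rw [hK]; exact_mod_cast hK1
  have hK0 : 0 < K := by linarith
  have hKn' : K ≤ n := by rw [hK]; exact_mod_cast hKn
  have hKM' : K * K ≤ M := by rw [hK]; exact_mod_cast hKM
  have hM0 : (0 : ℝ) < M := by exact_mod_cast hM
  -- Replacing `√M` by its integer part loses a factor of at most `2`; this turns `55` into `110` at
  -- the end.
  have hsqrt : √(M : ℝ) ≤ 2 * K := by
    rw [Real.sqrt_le_left (by linarith)]
    have h1 : M < (M.sqrt + 1) * (M.sqrt + 1) := Nat.lt_succ_sqrt M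
    have h2 : (M : ℝ) < (K + 1) * (K + 1) := by rw [hK]; exact_mod_cast h1
    nlinarith
  have hl1 : 1 ≤ l := by
    rw [hl, Real.le_logb_iff_rpow_le (by norm_num) (by linarith)]
    simpa using hn'
  have hlw1 : 1 ≤ lw := by
    rw [hlw, Real.le_logb_iff_rpow_le (by norm_num) (lt_max_of_lt_left (by norm_num))]
    simp
  have hZ1 : 1 ≤ Z := by
    rw [hZ, le_div_iff₀ hε]; linarith
  set Y := n * l / K with hY
  have hnY : n / K ≤ Y := by
    rw [hY]
    gcongr
    nlinarith
  have hY1 : 1 ≤ Y := le_trans (by rwa [le_div_iff₀ hK0, one_mul]) hnY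
  have hclogn : (Nat.clog 2 n : ℝ) ≤ 2 * l := by
    have h1 := clog_le_logb (m := n)
    rw [max_eq_right hn'] at h1
    linarith
  have hh : (P.h : ℝ) ≤ 3 * A * Y := by
    have h1 : ((n * Nat.clog 2 n / M.sqrt : ℕ) : ℝ) ≤ 2 * Y := by
      refine Nat.cast_div_le.trans ?_
      rw [hY, ← mul_div_assoc, ← hK]
      gcongr
      push_cast
      nlinarith
    have h2 : (P.h : ℝ) = A * (((n * Nat.clog 2 n / M.sqrt : ℕ) : ℝ) + 1) := by
      rw [hP, ofInput]
      push_cast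
      rfl
    rw [h2, show 3 * A * Y = A * (2 * Y + Y) by ring]
    gcongr
  have hE : (P.E : ℝ) ≤ 2 * Z := precision_le hε
  have hradius : (P.radius : ℝ) ≤ 9 * (A * Y * Z) := by
    have h1 : (P.radius : ℝ) = P.h * (P.E + 1) := by rw [radius]; push_cast; ring
    rw [h1]
    calc (P.h : ℝ) * (P.E + 1) ≤ 3 * A * Y * (2 * Z + Z) := by gcongr
      _ = _ := by ring
  have hAYZ : Y ≤ A * Y * Z := by
    calc Y = 1 * Y * 1 := by ring
      _ ≤ _ := by gcongr
  have hdiv : ((P.n * (P.K + 1) / P.M : ℕ) : ℝ) ≤ 2 * Y := by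
    refine Nat.cast_div_le.trans ?_
    change ((n * (M.sqrt + 1) : ℕ) : ℝ) / M ≤ _
    push_cast
    rw [← hK]
    calc (n : ℝ) * (K + 1) / M ≤ n * (2 * K) / (K * K) := by gcongr; linarith
      _ = 2 * (n / K) := by field_simp
      _ ≤ 2 * Y := by linarith
  have hrounds : (P.rounds : ℝ) + 1 ≤ 13 * (A * Y * Z) := by
    rw [rounds]
    push_cast only [Nat.cast_add, Nat.cast_one]
    linarith
  have hchunks : (P.chunks : ℝ) ≤ Y + 1 := by
    have h1 : ((P.n / P.M : ℕ) : ℝ) ≤ Y := by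
      refine Nat.cast_div_le.trans (le_trans ?_ hnY)
      change (n : ℝ) / M ≤ _
      gcongr
      nlinarith
    rw [chunks]
    push_cast only [Nat.cast_add, Nat.cast_one]
    linarith
  have hscales : (scales W : ℝ) ≤ 4 * lw := by
    have := clog_le_logb (m := W)
    rw [scales]
    push_cast
    linarith
  have h1 : (P.passes W : ℝ) = 1 + scales W * (P.rounds + 1) + P.chunks := by
    rw [passes, searchPasses]; push_cast; ring
  have hX : A * Y * Z ≤ A * Y * Z * lw := le_mul_of_one_le_right (by positivity) hlw1
  have h2 : (scales W : ℝ) * (P.rounds + 1) ≤ 4 * lw * (13 * (A * Y * Z)) := by gcongr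
  -- Here `52 = 4 * 13` accounts for the scales and rounds, and `3` for the first pass and the
  -- chunks, as `Y ≥ 1`.
  have h3 : (P.passes W : ℝ) ≤ 55 * (A * Y * Z * lw) := by
    rw [h1]; nlinarith
  refine h3.trans ?_
  have h4 : Y * Z * lw / 2 ≤ (1 + ε) * n * l * lw / (ε * √(M : ℝ)) := by
    have h5 : Y * Z * lw / 2 = (1 + ε) * n * l * lw / (ε * (2 * K)) := by
      rw [hY, hZ]; field_simp
    rw [h5]
    gcongr
  push_cast
  calc 55 * (A * Y * Z * lw) = 110 * A * (Y * Z * lw / 2) := by ring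
    _ ≤ _ := by gcongr

end SearchParams
end Main

/-! ### Success probability and the final assembly. -/

section Final

namespace SearchParams

variable {P : SearchParams}

variable (P) in
/-- The initial control: the source and `K` independent uniform vertices are the centres. -/
noncomputable def start (s : P.Vtx) : PMF P.bound.ctl :=
  haveI : Nonempty P.Vtx := ⟨s⟩
  (PMF.uniformOfFintype (Fin P.K → P.Vtx)).map fun f =>
    ⟨P.initCtl (Fin.cons s f), initCtl_mem _⟩

variable (P) in
/-- The W-Stream algorithm for approximate shortest paths. -/
noncomputable def algorithm : WStreamAlgorithm P.Vtx (P.Vtx × P.Vtx × ℕ) (P.Vtx × P.Vtx) :=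
  P.bound.algorithm P.start

/-- The memory before the first pass. -/
noncomputable def initMem (ctr : P.Ctr → P.Vtx) : P.algorithm.Mem :=
  ((⟨P.initCtl ctr, initCtl_mem ctr⟩ : P.bound.ctl), (⟨P.program.init, P.bound.init_mem⟩ : P.bound.acc))

lemma algorithm_start (s : P.Vtx) : haveI : Nonempty P.Vtx := ⟨s⟩
    P.algorithm.start s =
      (PMF.uniformOfFintype (Fin P.K → P.Vtx)).map fun f => initMem (Fin.cons s f) :=
  PMF.map_comp _ _ _

variable {G : SimpleGraph P.Vtx} {w : Sym2 P.Vtx → ℕ} {L : List (P.Vtx × P.Vtx × ℕ)}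

lemma haltsAfter_passes (hL : IsEdgeList G w L) (hcap : totalWeight G w ≤ P.cap)
    (ctr : P.Ctr → P.Vtx) :
    P.algorithm.HaltsAfter (initMem ctr) L (P.passes (totalWeight G w)) :=
  ⟨(P.bound.halted_config P.start _ L _).trans (halted_run_passes hL hcap ctr), fun k hk =>
    (P.bound.halted_config P.start _ L k).trans (not_halted_run hL hcap ctr k hk)⟩

lemma length_config_le (hL : IsEdgeList G w L) (hcap : totalWeight G w ≤ P.cap)
    (ctr : P.Ctr → P.Vtx) (k : ℕ) (hk : k ≤ P.passes (totalWeight G w)) :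
    (P.algorithm.config (initMem ctr) L k).2.length ≤ L.length * ((P.K + 1) * 2) + P.n :=
  (P.bound.length_config P.start _ L k).trans_le (length_run_le hL hcap ctr k hk)

lemma outputs (hL : IsEdgeList G w L) (hcap : totalWeight G w ≤ P.cap) (ctr : P.Ctr → P.Vtx) :
    P.algorithm.Outputs (initMem ctr) L
      ((P.program.run (P.initCtl ctr) L (P.passes (totalWeight G w))).2.map P.program.decode) :=
  ⟨_, haltsAfter_passes hL hcap ctr, (P.bound.map_decode_config P.start
    ⟨P.initCtl ctr, initCtl_mem ctr⟩ L _).symm⟩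

lemma success_probability {ε α : ℝ} (hn : 2 ≤ P.n) (hh : 1 ≤ P.h)
    (hK : (α + 1) * P.n * Real.log P.n ≤ P.h * P.K)
    (hL : IsEdgeList G w L) (hcap : totalWeight G w ≤ P.cap)
    (hε : ∀ a d : ℕ, d ≤ totalWeight G w → P.E * a ≤ (P.E + 2) * d → (a : ℝ) ≤ (1 + ε) * d)
    (s : P.Vtx) :
    ENNReal.ofReal (1 - 1 / (P.n : ℝ) ^ (α - 1)) ≤ (P.algorithm.start s).toOuterMeasure
      {q | ∃ out, P.algorithm.Outputs q L out ∧ RepresentsApproxShortestPaths G w ε s out} := by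
  classical
  have : Nonempty P.Vtx := ⟨s⟩
  obtain ⟨S, hS, hgood⟩ := exists_good_samples hn hh hK G w s
  rw [algorithm_start, PMF.toOuterMeasure_map_apply]
  refine le_toOuterMeasure_uniform S _ (fun f hf => ?_) (by simpa using hS)
  refine ⟨_, outputs hL hcap (Fin.cons s f), ?_⟩
  refine run_represents (ctr := Fin.cons s f) hL hcap hh hε fun v hv => ?_
  obtain ⟨Q, h1, h2, h3⟩ := hgood f hf v hv
  refine ⟨Q, h1, h2, fun i hi => ?_⟩
  obtain ⟨x, t, h4, h5, h6⟩ := h3 i hi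
  -- The sampled centres are shifted by one, since centre `0` is the source.
  exact ⟨x.succ, t, h4, h5, by rw [Fin.cons_succ]; exact h6⟩

/-- The `+ 1` in the hop bound compensates for the rounded-down quotient, and `log n ≤ Nat.clog 2 n`
because `log 2 < 1`. -/
lemma log_le_hop_bound {c A n M : ℕ} {ε α : ℝ} (hn : 2 ≤ n) (hM : 1 ≤ M) (hA : α + 1 ≤ A) :
    (α + 1) * n * Real.log n ≤
      ((ofInput c A n M ε hM).h : ℝ) * ((ofInput c A n M ε hM).K : ℝ) := by
  have hn0 : (0 : ℝ) < n := by positivity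
  have hl0 : 0 ≤ Real.log n := Real.log_nonneg (by exact_mod_cast (by omega : 1 ≤ n))
  have h1 : Real.log n ≤ Nat.clog 2 n := by
    have h2 : (n : ℝ) ≤ 2 ^ Nat.clog 2 n := by
      exact_mod_cast Nat.le_pow_clog (by norm_num) n
    calc Real.log n ≤ Real.log (2 ^ Nat.clog 2 n) := Real.log_le_log hn0 h2
      _ = Nat.clog 2 n * Real.log 2 := Real.log_pow _ _
      _ ≤ Nat.clog 2 n * 1 := by
        gcongr
        have := Real.log_two_lt_d9
        linarith
      _ = _ := mul_one _
  have h2 := Nat.lt_mul_div_succ (n * Nat.clog 2 n) (sqrt_pos_of_pos hM)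
  have h3 : A * (n * Nat.clog 2 n) ≤ (ofInput c A n M ε hM).h * (ofInput c A n M ε hM).K := by
    change _ ≤ A * (n * Nat.clog 2 n / M.sqrt + 1) * M.sqrt
    rw [mul_assoc]
    refine Nat.mul_le_mul_left _ ?_
    rw [mul_comm _ M.sqrt]
    exact h2.le
  calc (α + 1) * n * Real.log n ≤ A * n * Real.log n := by gcongr
    _ ≤ A * n * Nat.clog 2 n := by gcongr
    _ = ((A * (n * Nat.clog 2 n) : ℕ) : ℝ) := by push_cast; ring
    _ ≤ _ := by exact_mod_cast h3

end SearchParams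

end Final

open SearchParams in
theorem mainTheorem11 (c : ℕ) (α : ℝ) (hα : 1 < α) :
    ∃ C : ℕ, ∀ (n M : ℕ) (ε : ℝ), 2 ≤ n → 1 ≤ M → M ≤ n ^ 2 → 0 < ε →
      ∃ A : WStreamAlgorithm (Fin n) (Fin n × Fin n × ℕ) (Fin n × Fin n),
        -- the working memory has `O(M log n)` bits, and a record has `O(log n)` bits
        A.memSize ≤ n ^ (C * M) ∧ A.recSize ≤ n ^ C ∧
        ∀ (G : SimpleGraph (Fin n)) (w : Sym2 (Fin n) → ℕ) (s : Fin n)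
          (L : List (Fin n × Fin n × ℕ)),
          IsEdgeList G w L → totalWeight G w ≤ n ^ c →
          -- whatever the random choices are, passes and intermediate streams are bounded
          (∀ q ∈ (A.start s).support, ∃ p : ℕ, A.HaltsAfter q L p ∧
            (p : ℝ) ≤ C * ((1 + ε) * n * Real.logb 2 n *
              Real.logb 2 (max 2 (totalWeight G w : ℝ)) / (ε * √(M : ℝ))) ∧
            ∀ k ≤ p, ((A.config q L k).2.length : ℝ) ≤ C * (n + L.length) * √(M : ℝ)) ∧
          -- with high probability, all the paths are approximate shortest paths
          ENNReal.ofReal (1 - 1 / (n : ℝ) ^ (α - 1)) ≤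
            (A.start s).toOuterMeasure
              {q | ∃ out, A.Outputs q L out ∧ RepresentsApproxShortestPaths G w ε s out} := by
  obtain ⟨A, hA⟩ := exists_nat_ge (α + 1)
  have hA1 : 1 ≤ A := by
    have : (1 : ℝ) ≤ A := by linarith
    exact_mod_cast this
  -- All sizes are powers of `q = n ^ (A + 2 * c + 17)`. The memory has at most `q ^ (18 * M) * q ^
  -- (14 * M)` states, which gives `32`; the pass bound gives `110 * A`.
  refine ⟨32 * (A + 2 * c + 17) + 110 * A, fun n M ε hn hM hMn hε => ?_⟩
  have hn1 : 1 ≤ n := by omega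
  have hK1 := sqrt_pos_of_pos hM
  have hKM : M.sqrt * M.sqrt ≤ M := Nat.sqrt_le M
  have hq := boundedBy_ofInput (c := c) (A := A) (ε := ε) hn hM hMn
  have hKK : ((ofInput c A n M ε hM).K + 1) * ((ofInput c A n M ε hM).K + 1) ≤
      4 * (ofInput c A n M ε hM).M := by
    change (M.sqrt + 1) * (M.sqrt + 1) ≤ 4 * M
    nlinarith
  have hK2 : (ofInput c A n M ε hM).K + 1 ≤ 2 * (ofInput c A n M ε hM).M := by
    change M.sqrt + 1 ≤ 2 * M
    nlinarith
  refine ⟨(ofInput c A n M ε hM).algorithm, ?_, ?_, ?_⟩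
  · refine (Eq.le (StreamProgram.Bound.memSize_algorithm _ _)).trans ?_
    calc _ ≤ (n ^ (A + 2 * c + 17)) ^ (18 * M) * (n ^ (A + 2 * c + 17)) ^ (14 * M) :=
          Nat.mul_le_mul (hq.card_ctl hKK hK2) (hq.card_acc hKK)
      _ = n ^ (32 * (A + 2 * c + 17) * M) := by ring
      _ ≤ _ := Nat.pow_le_pow_right hn1 (Nat.mul_le_mul_right _ (by omega))
  · refine (Eq.le (StreamProgram.Bound.recSize_algorithm _ _)).trans (hq.card_recs.trans ?_)
    rw [← pow_mul]
    exact Nat.pow_le_pow_right hn1 (by omega)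
  · intro G w s L hL hW
    refine ⟨fun q hq => ?_, ?_⟩
    · have : Nonempty (Fin n) := ⟨s⟩
      rw [algorithm_start (P := ofInput c A n M ε hM) s, PMF.mem_support_map_iff] at hq
      obtain ⟨f, -, rfl⟩ := hq
      refine ⟨_, haltsAfter_passes (P := ofInput c A n M ε hM) hL hW _,
        (passes_ofInput_le hn hM hMn hε hA1 _).trans ?_, fun k hk => ?_⟩
      · have h0 : 0 ≤ Real.logb 2 (n : ℝ) :=
          Real.logb_nonneg (by norm_num) (by exact_mod_cast hn1)
        have h1 : 0 ≤ Real.logb 2 (max 2 (totalWeight G w : ℝ)) :=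
          Real.logb_nonneg (by norm_num) (le_max_of_le_left (by norm_num))
        exact mul_le_mul_of_nonneg_right (Nat.cast_le.mpr (by omega)) (by positivity)
      · have h1 : ((((ofInput c A n M ε hM).algorithm.config
            (initMem (Fin.cons s f)) L k).2.length : ℕ) : ℝ) ≤
            ((L.length * ((M.sqrt + 1) * 2) + n : ℕ) : ℝ) :=
          Nat.cast_le.mpr (length_config_le (P := ofInput c A n M ε hM) hL hW _ k hk)
        refine h1.trans ?_
        have h2 : ((M.sqrt : ℕ) : ℝ) ≤ √(M : ℝ) := Real.nat_sqrt_le_real_sqrt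
        have h3 : (1 : ℝ) ≤ ((M.sqrt : ℕ) : ℝ) := by exact_mod_cast hK1
        have h4 : (4 : ℝ) ≤ (32 * (A + 2 * c + 17) + 110 * A : ℕ) := by
          exact_mod_cast (by omega : 4 ≤ 32 * (A + 2 * c + 17) + 110 * A)
        calc ((L.length * ((M.sqrt + 1) * 2) + n : ℕ) : ℝ)
            = L.length * ((((M.sqrt : ℕ) : ℝ) + 1) * 2) + n := by push_cast; ring
          _ ≤ L.length * (4 * √(M : ℝ)) + n * (4 * √(M : ℝ)) := by
            exact add_le_add (mul_le_mul_of_nonneg_left (by linarith) (Nat.cast_nonneg _))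
              (le_mul_of_one_le_right (Nat.cast_nonneg n) (by linarith))
          _ = 4 * (n + L.length) * √(M : ℝ) := by ring
          _ ≤ _ := by gcongr
    · refine success_probability (P := ofInput c A n M ε hM) hn ?_ (log_le_hop_bound hn hM hA)
        hL hW (fun a d hd h => le_of_precision hε (hd.trans hW) h) s
      exact Nat.mul_pos hA1 (Nat.succ_pos _)
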